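/- **Setting.** Let $a<b$, let $M\ge 0$ be an integer and let $c_l,c_r,\kappa_l,\kappa_r\in\mathbb R$. Let $0<\mu^{\min}<\mu^{\max}<1$, $0<\nu^{\min}<\nu^{\max}<1$, $\varrho\in L^1(\mu^{\min},\mu^{\max})$ and $\rho\in L^1(\nu^{\min},\nu^{\max})$. Write ${}_aD_x^\mu$, ${}_xD_b^\mu$ for the left and right Riemann–Liouville derivatives, $P_n^{\alpha,\beta}$ for the Jacobi polynomials, $P_n=P_n^{0,0}$ for the Legendre polynomials, and $\xi(x)=2\frac{x-a}{b-a}-1$. For $m\ge1$ put $$\phi_m=\sigma_m(P_{m+1}-P_{m-1}),\quad \Phi_m=\tilde\sigma_m(P_{m+1}-P_{m-1}),\quad \sigma_m=2+(-1)^m,\quad \tilde\sigma_m=2(-1)^m+1 .$$ For $w\in\{\varrho,\rho\}$ on its interval $(w^{\min},w^{\max})$ and $1\le r,n\le M$ let $$\{S_l^w\}_{r,n}=\int_{w^{\min}}^{w^{\max}}\! w(\mu)\int_a^b {}_aD_x^\mu(\phi_n\circ\xi)\;{}_xD_b^\mu(\Phi_r\circ\xi)\,dx\,d\mu,$$ $$\{S_r^w\}_{r,n}=\int_{w^{\min}}^{w^{\max}}\!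 w(\mu)\int_a^b {}_aD_x^\mu(\Phi_r\circ\xi)\;{}_xD_b^\mu(\phi_n\circ\xi)\,dx\,d\mu .$$ Let $S^{Tot}$ be the $M\times M$ matrix with entries $\{S^{Tot}\}_{r,n}=A(\phi_n\circ\xi,\Phi_r\circ\xi)$, where, with $(u,v)_\mu=\int_a^b{}_aD_x^\mu u\;{}_xD_b^\mu v\,dx$, $$A(u,v)=\int_{\mu^{\min}}^{\mu^{\max}}\!\varrho(\mu)\,[c_l (u,v)_\mu+c_r (v,u)_\mu]\,d\mu-\int_{\nu^{\min}}^{\nu^{\max}}\!\rho(\nu)\,[\kappa_l (u,v)_\nu+\kappa_r (v,u)_\nu]\,d\nu .$$ Let $\vartheta_w(s)=w^{\min}+\frac{w^{\max}-w^{\min}}2(s+1)$, so that $\vartheta_w$ maps $[-1,1]$ onto $[w^{\min},w^{\max}]$, and for $r,n\ge 0$ let $$\widetilde S^w_{r,n}=\int_{-1}^1 w(\vartheta_w(s))\Big(\tfrac2{b-a}\Big)^{2\vartheta_w(s)-1}\int_{-1}^1{}_{-1}D_\xi^{\vartheta_w(s)}P_n\;{}_{\xi}D_1^{\vartheta_w(s)}P_r\,d\xi\,ds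 .$$ **Claim.** All integrals above and below converge, and the following hold. 1. $S^{Tot}$ is symmetric and $S^{Tot}=c_lS_l^\varrho+c_rS_r^\varrho-\kappa_lS_l^\rho-\kappa_rS_r^\rho$. Each of $S_l^\varrho,S_r^\varrho,S_l^\rho,S_r^\rho$ is symmetric. 2. For $0<\mu<1$, $n\ge0$ and $-1<\xi<1$: ${}_{-1}D_\xi^\mu P_n=\frac{\Gamma(n+1)}{\Gamma(n-\mu+1)}P_n^{\mu,-\mu}(\xi)(1+\xi)^{-\mu}$ and ${}_\xi D_1^\mu P_n=\frac{\Gamma(n+1)}{\Gamma(n-\mu+1)}P_n^{-\mu,\mu}(\xi)(1-\xi)^{-\mu}$. 3. For $w\in\{\varrho,\rho\}$ and $1\le r,n\le M$, with $\beta_1=\tilde\sigma_r\sigma_n\frac{w^{\max}-w^{\min}}2$, $$\{S_l^w\}_{r,n}=\beta_1\big[\widetilde S^w_{r+1,n+1}-\widetilde S^w_{r+1,n-1}-\widetilde S^w_{r-1,n+1}+\widetilde S^w_{r-1,n-1}\big],$$ $$\{S_r^w\}_{r,n}=\beta_1\big[\widetilde S^w_{n+1,r+1}-\widetilde S^w_{n-1,r+1}-\widetilde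 S^w_{n+1,r-1}+\widetilde S^w_{n-1,r-1}\big].$$ 4. For $w\in\{\varrho,\rho\}$ and $0\le r,n\le M+1$: $\widetilde S^w_{r,n}=(-1)^{r+n}\widetilde S^w_{n,r}$ and $\widetilde S^w_{r,n}=\int_{-1}^1F_{r,n}(s)\,ds$, where, with $\mu=\vartheta_w(s)$, $$F_{r,n}(s)=w(\mu)\Big(\tfrac2{b-a}\Big)^{2\mu-1}\tfrac{\Gamma(r+1)}{\Gamma(r-\mu+1)}\tfrac{\Gamma(n+1)}{\Gamma(n-\mu+1)}\int_{-1}^1(1-\xi^2)^{-\mu}P_r^{-\mu,\mu}(\xi)P_n^{\mu,-\mu}(\xi)\,d\xi .$$ For every $\mu\in[w^{\min},w^{\max}]$ the integral over $\xi$ is computed exactly by the $Q$-point Gauss rule for the weight $(1-\xi^2)^{-\mu}$ whenever $Q\ge M+2$. 5. Let $s_1,\dots,s_Q$ and $w_1,\dots,w_Q$ be the nodes and weights of the $Q$-point Gauss–Legendre rule on $[-1,1]$. For $w\in\{\varrho,\rho\}$ and $0\le r,n\le M+1$: if $p$ is a real polynomial of degree less than $2Q$ and $|F_{r,n}-p|\le\varepsilon$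 on $[-1,1]$, then $|\widetilde S^w_{r,n}-\sum_q w_qF_{r,n}(s_q)|\le4\varepsilon$; in particular the rule is exact if $F_{r,n}$ is a polynomial of degree less than $2Q$. If $w$ is continuous on $[w^{\min},w^{\max}]$, then $\sum_q w_qF_{r,n}(s_q)\to\widetilde S^w_{r,n}$ as $Q\to\infty$. -/

import Mathlib

noncomputable section

namespace StiffnessMatrix

open Polynomial

/-! ### Riemann–Liouville fractional derivatives -/

/-- Left-sided Riemann–Liouville derivative of order `σ ≥ 0` with base point `a`. The integer
`n = ⌊σ⌋ + 1` equals `⌈σ⌉` for every non-integer order; for integer orders this choice gives the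
classical derivative. It is only evaluated at interior points `a < x`. -/
def leftRL (a σ : ℝ) (g : ℝ → ℝ) (x : ℝ) : ℝ :=
  1 / Real.Gamma ((⌊σ⌋₊ + 1 : ℕ) - σ) *
    iteratedDeriv (⌊σ⌋₊ + 1)
      (fun y => ∫ s in a..y, g s / (y - s) ^ (σ + 1 - (⌊σ⌋₊ + 1 : ℕ))) x

/-- Right-sided Riemann–Liouville derivative of order `σ ≥ 0` with base point `b`. -/
def rightRL (b σ : ℝ) (g : ℝ → ℝ) (x : ℝ) : ℝ :=
  (-1) ^ (⌊σ⌋₊ + 1) / Real.Gamma ((⌊σ⌋₊ + 1 : ℕ) - σ) *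
    iteratedDeriv (⌊σ⌋₊ + 1)
      (fun y => ∫ s in y..b, g s / (s - y) ^ (σ + 1 - (⌊σ⌋₊ + 1 : ℕ))) x

/-! ### Jacobi and Legendre polynomials -/

/-- The Jacobi polynomial
`P_n^{α,β}(x) = (1/n!) ∑ₖ C(n,k) (n+α+β+1)ₖ (α+k+1)ₙ₋ₖ ((x-1)/2)ᵏ`,
where `(z)ₖ` is the rising factorial. -/
def jacobi (α β : ℝ) (n : ℕ) : ℝ[X] :=
  ∑ k ∈ Finset.range (n + 1),
    C ((n.choose k : ℝ) * (ascPochhammer ℝ k).eval (n + α + β + 1) *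
        (ascPochhammer ℝ (n - k)).eval (α + k + 1) / (n.factorial : ℝ)) *
      (C (1 / 2) * (X - 1)) ^ k

/-- The Legendre polynomial `P_n = P_n^{0,0}`. -/
def legendre (n : ℕ) : ℝ[X] := jacobi 0 0 n

/-! ### Spatial basis and test functions -/

/-- `σ_m = 2 + (-1)^m`. -/
def trialCoeff (m : ℕ) : ℝ := 2 + (-1) ^ m

/-- `σ̃_k = 2 (-1)^k + 1`. -/
def testCoeff (k : ℕ) : ℝ := 2 * (-1) ^ k + 1

/-- The affine map of `[a, b]` onto `[-1, 1]`. -/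
def toStd (a b x : ℝ) : ℝ := 2 * (x - a) / (b - a) - 1

/-- The basis function `φ_m ∘ ξ` on `[a, b]`, where `φ_m = σ_m (P_{m+1} - P_{m-1})`, `m ≥ 1`. -/
def trialFn (a b : ℝ) (m : ℕ) (x : ℝ) : ℝ :=
  trialCoeff m *
    ((legendre (m + 1)).eval (toStd a b x) - (legendre (m - 1)).eval (toStd a b x))

/-- The test function `Φ_k ∘ ξ` on `[a, b]`, where `Φ_k = σ̃_k (P_{k+1} - P_{k-1})`, `k ≥ 1`. -/
def testFn (a b : ℝ) (k : ℕ) (x : ℝ) : ℝ :=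
  testCoeff k *
    ((legendre (k + 1)).eval (toStd a b x) - (legendre (k - 1)).eval (toStd a b x))

/-! ### Distributed orders and stiffness matrices -/

/-- A distribution of half-orders: an integrable weight on an interval `(lo, hi)`, where
`0 < lo < hi < 1`. (No sign of the weight is required.) -/
structure OrderDistribution where
  lo : ℝ
  hi : ℝ
  weight : ℝ → ℝ
  lo_pos : 0 < lo
  lo_lt_hi : lo < hi
  hi_lt_one : hi < 1
  integrable : MeasureTheory.IntegrableOn weight (Set.Ioo lo hi)

/-- `({}_aD_x^μ u, {}_xD_b^μ v)` in `L²(a, b)`. -/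
def fracPairing (a b μ : ℝ) (u v : ℝ → ℝ) : ℝ :=
  ∫ x in a..b, leftRL a μ u x * rightRL b μ v x

/-- The spatial part, in one coordinate, of the bilinear form of the weak problem. -/
def spatialForm (a b : ℝ) (ϱ ρ : OrderDistribution) (cl cr κl κr : ℝ) (u v : ℝ → ℝ) : ℝ :=
  (∫ μ in ϱ.lo..ϱ.hi,
      ϱ.weight μ * (cl * fracPairing a b μ u v + cr * fracPairing a b μ v u)) -
    ∫ ν in ρ.lo..ρ.hi,
      ρ.weight ν * (κl * fracPairing a b ν u v + κr * fracPairing a b ν v u)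

/-- The total spatial stiffness matrix: the form tested with the basis functions `φ_n`, `n ≤ M`
(columns), against the test functions `Φ_r`, `r ≤ M` (rows). The index `i : Fin M` stands for the
mode number `i + 1`. -/
def totalStiffness (a b : ℝ) (ϱ ρ : OrderDistribution) (cl cr κl κr : ℝ) (M : ℕ) :
    Matrix (Fin M) (Fin M) ℝ :=
  Matrix.of fun r n =>
    spatialForm a b ϱ ρ cl cr κl κr (trialFn a b (n + 1)) (testFn a b (r + 1))

/-- The matrix `S_l`: left derivative on the basis function, right derivative on the test
function. -/
def leftStiffness (a b : ℝ) (w : OrderDistribution) (M : ℕ) : Matrix (Fin M) (Fin M) ℝ :=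
  Matrix.of fun r n => ∫ μ in w.lo..w.hi,
    w.weight μ * fracPairing a b μ (trialFn a b (n + 1)) (testFn a b (r + 1))

/-- The matrix `S_r`: right derivative on the basis function, left derivative on the test
function. -/
def rightStiffness (a b : ℝ) (w : OrderDistribution) (M : ℕ) : Matrix (Fin M) (Fin M) ℝ :=
  Matrix.of fun r n => ∫ μ in w.lo..w.hi,
    w.weight μ * fracPairing a b μ (testFn a b (r + 1)) (trialFn a b (n + 1))

/-! ### Modal integrals in standard coordinates -/

namespace OrderDistribution

/-- The affine map `ϑ` of `[-1, 1]` onto `[lo, hi]`. -/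
def theta (w : OrderDistribution) (s : ℝ) : ℝ := w.lo + (w.hi - w.lo) * (s + 1) / 2

/-- `S̃_{r,n}`, the pairing of Legendre polynomials on `[-1, 1]`, integrated over the order. The
power of `2 / (b - a)` is the Jacobian of the map of `[a, b]` onto `[-1, 1]`; it is `1` for
`[a, b] = [-1, 1]`. -/
def modal (w : OrderDistribution) (a b : ℝ) (r n : ℕ) : ℝ :=
  ∫ s in (-1 : ℝ)..1, w.weight (w.theta s) * (2 / (b - a)) ^ (2 * w.theta s - 1) *
    fracPairing (-1) 1 (w.theta s) (fun ξ => (legendre n).eval ξ) (fun ξ => (legendre r).eval ξ)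

end OrderDistribution

/-- The integral `∫ (1-ξ²)^{-μ} P_r^{-μ,μ}(ξ) P_n^{μ,-μ}(ξ) dξ` over `[-1, 1]`. -/
def jacobiIntegral (μ : ℝ) (r n : ℕ) : ℝ :=
  ∫ ξ in (-1 : ℝ)..1,
    (1 - ξ ^ 2) ^ (-μ) * ((jacobi (-μ) μ r).eval ξ * (jacobi μ (-μ) n).eval ξ)

namespace OrderDistribution

/-- The closed form of the integrand of `S̃_{r,n}` as a function of the standard order variable. -/
def orderIntegrand (w : OrderDistribution) (a b : ℝ) (r n : ℕ) (s : ℝ) : ℝ :=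
  w.weight (w.theta s) * (2 / (b - a)) ^ (2 * w.theta s - 1) *
    (Real.Gamma (r + 1) / Real.Gamma (r - w.theta s + 1)) *
    (Real.Gamma (n + 1) / Real.Gamma (n - w.theta s + 1)) *
    jacobiIntegral (w.theta s) r n

end OrderDistribution

/-! ### Gauss quadrature -/

/-- The nodes of the `Q`-point Gauss rule on `[-1, 1]` for the weight `(1-x²)^α`, `α > -1`:
the zeros of `P_Q^{α,α}`. For `α = 0` these are the Gauss–Legendre nodes. -/
def gaussNodes (α : ℝ) (Q : ℕ) : Finset ℝ := (jacobi α α Q).roots.toFinset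

/-- The Gauss weight at the node `x`: the integral of the Lagrange basis polynomial of `x` against
`(1-y²)^α`. -/
def gaussWeight (α : ℝ) (Q : ℕ) (x : ℝ) : ℝ :=
  ∫ y in (-1 : ℝ)..1, (1 - y ^ 2) ^ α * (Lagrange.basis (gaussNodes α Q) id x).eval y

/-- The `Q`-point Gauss rule for the weight `(1-x²)^α` applied to `f`. -/
def gaussSum (α : ℝ) (Q : ℕ) (f : ℝ → ℝ) : ℝ :=
  ∑ x ∈ gaussNodes α Q, gaussWeight α Q x * f x

end StiffnessMatrix

end

/-! Fractional derivatives. Expand P_n in powers of 1 - x and differentiate term by term. A Beta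
integral gives each power, and the resulting Gamma factors turn the coefficients of P_n into those
of P_n^{-μ,μ} (`jacobiCoeff_zero_mul_Gamma`, `hasRightRL_legendre`). The reflection x ↦ -x gives the
left derivative. Under the affine map of [a, b] onto [-1, 1] each derivative of order μ scales by
(2/(b-a))^μ and dx by (b-a)/2, so bilinearity writes every entry as four modal integrals with
exponent 2μ - 1. All factors except the weight are continuous in μ on [lo, hi], a subset of (0, 1),
so an integrable weight suffices for convergence.

Symmetry. The reflection ξ ↦ -ξ exchanges the parameters (-μ, μ) and (μ, -μ), so swapping the
indices of a modal integral costs the sign (-1)^(r+n) (`orderKernel_symm`). Since σ̃_m = (-1)^m σ_m,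
the coefficients absorb exactly this sign (`testCoeff_mul_trialCoeff`).

Quadrature. The Jacobi differential operator is self-adjoint for its weight, hence P_Q^{α,α} is
orthogonal to all lower degrees. Therefore no nonconstant factor of it keeps one sign on (-1, 1)
(`not_dvd_jacobi_of_nonneg`), which forces Q simple zeros there. Division by P_Q then gives
exactness below degree 2Q, and squares of Lagrange polynomials give nonnegative weights. The error
bound follows, and convergence follows by Weierstrass approximation. -/

namespace StiffnessMatrix

open Polynomial MeasureTheory

/-! ### Jacobi polynomials: differential equation, parity and degree -/

/-- The coefficient of `((x-1)/2)^k` in `P_n^{α,β}`. -/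
noncomputable def jacobiCoeff (α β : ℝ) (n k : ℕ) : ℝ :=
  (n.choose k : ℝ) * (ascPochhammer ℝ k).eval (n + α + β + 1) *
    (ascPochhammer ℝ (n - k)).eval (α + k + 1) / (n.factorial : ℝ)

theorem jacobi_eval (α β : ℝ) (n : ℕ) (x : ℝ) :
    (jacobi α β n).eval x =
      ∑ k ∈ Finset.range (n + 1), jacobiCoeff α β n k * ((x - 1) / 2) ^ k := by
  unfold jacobi jacobiCoeff
  rw [eval_finsetSum]
  refine Finset.sum_congr rfl fun k _ => ?_
  simp only [eval_mul, eval_C, eval_pow, eval_sub, eval_X, eval_one]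
  congr 2
  ring

theorem ascPochhammer_eval_succ_left (m : ℕ) (z : ℝ) :
    (ascPochhammer ℝ (m + 1)).eval z = z * (ascPochhammer ℝ m).eval (z + 1) := by
  simp [ascPochhammer_succ_left, eval_comp]

/-- This is the two-term recurrence that the Jacobi equation imposes on a series in t = (x-1)/2,
where the operator maps t^k to a combination of t^(k-1) and t^k only. -/
theorem jacobiCoeff_succ (α β : ℝ) {n k : ℕ} (hk : k < n) :
    ((k : ℝ) + 1) * (k + 1 + α) * jacobiCoeff α β n (k + 1) =
      ((n : ℝ) * (n + α + β + 1) - k * (k + α + β + 1)) * jacobiCoeff α β n k := by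
  obtain ⟨m, rfl⟩ := Nat.exists_eq_add_of_lt hk
  have h1 : k + m + 1 - k = m + 1 := by omega
  have h2 : k + m + 1 - (k + 1) = m := by omega
  have h3 : ((k + m + 1).choose (k + 1) : ℝ) * (k + 1) = (k + m + 1).choose k * (m + 1) := by
    have := Nat.choose_succ_right_eq (k + m + 1) k
    rw [h1] at this
    exact_mod_cast this
  unfold jacobiCoeff
  rw [h1, h2, ascPochhammer_eval_succ_left m, ascPochhammer_succ_eval]
  push_cast
  have h4 : α + (k + 1 : ℝ) + 1 = α + k + 1 + 1 := by ring
  rw [h4]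
  generalize (ascPochhammer ℝ m).eval (α + k + 1 + 1) = A
  generalize (ascPochhammer ℝ k).eval ((k : ℝ) + m + 1 + α + β + 1) = B
  generalize ((k + m + 1).choose (k + 1) : ℝ) = u at *
  generalize ((k + m + 1).choose k : ℝ) = v at *
  linear_combination
    (k + 1 + α) * B * A * (k + m + 1 + α + β + 1 + k) / ((k + m + 1).factorial : ℝ) * h3

/-- The Jacobi differential operator, without its zeroth-order term. -/
noncomputable def jacobiOp (α β : ℝ) (p : ℝ[X]) : ℝ[X] :=
  (1 - X ^ 2) * derivative (derivative p) + (C (β - α) - C (α + β + 2) * X) * derivative p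

theorem jacobiOp_add (α β : ℝ) (p q : ℝ[X]) :
    jacobiOp α β (p + q) = jacobiOp α β p + jacobiOp α β q := by
  simp [jacobiOp]; ring

theorem jacobiOp_C_mul (α β c : ℝ) (p : ℝ[X]) :
    jacobiOp α β (C c * p) = C c * jacobiOp α β p := by
  simp [jacobiOp]; ring

theorem jacobiOp_sum (α β : ℝ) {ι : Type*} (s : Finset ι) (f : ι → ℝ[X]) :
    jacobiOp α β (∑ i ∈ s, f i) = ∑ i ∈ s, jacobiOp α β (f i) := by
  simp [jacobiOp, Finset.mul_sum, Finset.sum_add_distrib]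

theorem jacobiOp_basis_eval (α β : ℝ) (k : ℕ) (x : ℝ) :
    (jacobiOp α β ((C (1 / 2) * (X - 1)) ^ k)).eval x =
      -(k * (k + α)) * ((x - 1) / 2) ^ (k - 1) -
        k * (k + α + β + 1) * ((x - 1) / 2) ^ k := by
  rcases k with _ | _ | k
  · simp [jacobiOp]
  · simp [jacobiOp]; ring
  · simp [jacobiOp, derivative_pow]; ring

/-- The Jacobi differential equation. -/
theorem jacobiOp_jacobi (α β : ℝ) (n : ℕ) :
    jacobiOp α β (jacobi α β n) = C (-(n * (n + α + β + 1))) * jacobi α β n := by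
  refine Polynomial.funext fun x => ?_
  rw [eval_mul, eval_C, jacobi_eval]
  unfold jacobi
  simp only [jacobiOp_sum, jacobiOp_C_mul, eval_finsetSum, eval_mul, eval_C, jacobiOp_basis_eval]
  -- Shift the index by one: the term k = 0 on the left vanishes through its factor k, the term k =
  -- n on the right because the two eigenvalues coincide there. The rest is the recurrence.
  have key : ∑ k ∈ Finset.range (n + 1),
      jacobiCoeff α β n k * (k * (k + α)) * ((x - 1) / 2) ^ (k - 1) =
      ∑ k ∈ Finset.range (n + 1), (n * (n + α + β + 1) - k * (k + α + β + 1)) *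
        jacobiCoeff α β n k * ((x - 1) / 2) ^ k := by
    rw [Finset.sum_range_succ', Finset.sum_range_succ _ n]
    simp only [Nat.cast_zero, zero_mul, mul_zero, add_zero, sub_self]
    refine Finset.sum_congr rfl fun k hk => ?_
    rw [← jacobiCoeff_succ α β (Finset.mem_range.1 hk)]
    push_cast
    ring
  rw [Finset.mul_sum]
  rw [← sub_eq_zero] at key ⊢
  rw [← Finset.sum_sub_distrib] at key ⊢
  rw [← neg_eq_zero, ← Finset.sum_neg_distrib, ← key]
  refine Finset.sum_congr rfl fun k _ => ?_
  simp only [jacobiCoeff]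
  ring

theorem coeff_X_mul_derivative_eq (p : ℝ[X]) (m : ℕ) :
    (X * derivative p).coeff m = m * p.coeff m := by
  cases m with
  | zero => simp
  | succ m => rw [coeff_X_mul, coeff_derivative]; push_cast; ring

theorem jacobiOp_coeff (α β : ℝ) (p : ℝ[X]) (m : ℕ) :
    (jacobiOp α β p).coeff m = (m + 1) * (m + 2) * p.coeff (m + 2) +
      (β - α) * ((m + 1) * p.coeff (m + 1)) - m * (m + α + β + 1) * p.coeff m := by
  -- The Euler operator x d/dx is diagonal on monomials, and x²p'' = x(xp')' - xp'.
  have h : jacobiOp α β p = derivative (derivative p) - X * derivative (X * derivative p) +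
      X * derivative p + C (β - α) * derivative p - C (α + β + 2) * (X * derivative p) := by
    simp [jacobiOp]; ring
  rw [h]
  simp only [coeff_sub, coeff_add, coeff_C_mul, coeff_X_mul_derivative_eq, coeff_derivative]
  push_cast
  ring

/-- The operator does not raise degrees and multiplies a leading coefficient of degree m by
-m(m+α+β+1). This differs from the eigenvalue for n by (n-m)(n+m+α+β+1), which is nonzero for m < n.
-/
theorem eq_zero_of_jacobiOp_eq {α β : ℝ} (h : -2 < α + β) {n : ℕ} {p : ℝ[X]} (hp : p.degree < n)
    (he : jacobiOp α β p = C (-(n * (n + α + β + 1))) * p) : p = 0 := by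
  by_contra h0
  have hm : p.natDegree < n := (natDegree_lt_iff_degree_lt h0).2 hp
  have hc := congrArg (fun q => q.coeff p.natDegree) he
  simp only [jacobiOp_coeff, coeff_C_mul] at hc
  rw [coeff_eq_zero_of_natDegree_lt (by omega : p.natDegree < p.natDegree + 2),
    coeff_eq_zero_of_natDegree_lt (by omega : p.natDegree < p.natDegree + 1)] at hc
  have hl : p.coeff p.natDegree ≠ 0 := by simpa using h0
  have hprod : (((n : ℝ) - p.natDegree) * (n + p.natDegree + α + β + 1)) *
      p.coeff p.natDegree = 0 := by linear_combination hc
  have hn : ((p.natDegree : ℝ)) + 1 ≤ n := by exact_mod_cast hm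
  have hd : (0 : ℝ) ≤ p.natDegree := Nat.cast_nonneg _
  refine mul_ne_zero (mul_ne_zero ?_ ?_) hl hprod <;> linarith

theorem natDegree_jacobi_le (α β : ℝ) (n : ℕ) : (jacobi α β n).natDegree ≤ n := by
  refine natDegree_sum_le_of_forall_le _ _ fun k hk => ?_
  refine (natDegree_C_mul_le _ _).trans (natDegree_pow_le.trans ?_)
  have h1 : (C (1 / 2 : ℝ) * (X - 1)).natDegree ≤ 1 :=
    (natDegree_C_mul_le _ _).trans (by simpa using natDegree_X_sub_C_le (1 : ℝ))
  have := Finset.mem_range.1 hk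
  nlinarith

theorem coeff_jacobi_self (α β : ℝ) (n : ℕ) : (jacobi α β n).coeff n =
    (ascPochhammer ℝ n).eval (n + α + β + 1) / n.factorial * (1 / 2) ^ n := by
  have hT : ∀ k, (C (1 / 2 : ℝ) * (X - 1)) ^ k = C ((1 / 2 : ℝ) ^ k) * (X - C 1) ^ k := by
    intro k; rw [mul_pow, ← C_pow, C_1]
  unfold jacobi
  rw [finsetSum_coeff, Finset.sum_range_succ, Finset.sum_eq_zero]
  · have hm : ((X - C (1 : ℝ)) ^ n).coeff n = 1 := by
      have := (monic_X_sub_C (1 : ℝ)).pow n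
      have hd : ((X - C (1 : ℝ)) ^ n).natDegree = n := by
        rw [natDegree_pow, natDegree_X_sub_C, mul_one]
      rwa [Monic, leadingCoeff, hd] at this
    rw [coeff_C_mul, hT, coeff_C_mul, hm]
    simp
  · intro k hk
    have hk := Finset.mem_range.1 hk
    rw [coeff_C_mul, hT, coeff_C_mul, coeff_eq_zero_of_natDegree_lt, mul_zero, mul_zero]
    rwa [natDegree_pow, natDegree_X_sub_C, mul_one]

theorem jacobiOp_comp_neg (α β : ℝ) (p : ℝ[X]) :
    jacobiOp β α (p.comp (-X)) = (jacobiOp α β p).comp (-X) := by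
  refine Polynomial.funext fun x => ?_
  simp [jacobiOp, derivative_comp, eval_comp]
  ring

/-- `P_n^{α,β}(-x) = (-1)^n P_n^{β,α}(x)`. -/
theorem jacobi_eval_neg {α β : ℝ} (h : -2 < α + β) (n : ℕ) (x : ℝ) :
    (jacobi α β n).eval (-x) = (-1) ^ n * (jacobi β α n).eval x := by
  -- Reflection carries the operator for (α, β) into the one for (β, α), so both polynomials solve
  -- the same eigenvalue equation. Their leading coefficients agree, so the difference has degree
  -- below n and vanishes by uniqueness.
  have hz : (jacobi α β n).comp (-X) - C ((-1) ^ n) * jacobi β α n = 0 := by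
    refine eq_zero_of_jacobiOp_eq (α := β) (β := α) (n := n) (by linarith) ?_ ?_
    · refine (degree_lt_iff_coeff_zero _ _).2 fun m hm => ?_
      have hX : (-X : ℝ[X]) = C (-1) * X := by simp
      rw [coeff_sub, coeff_C_mul, hX, comp_C_mul_X_coeff]
      rcases hm.eq_or_lt with rfl | hm
      · rw [coeff_jacobi_self, coeff_jacobi_self, add_right_comm (n : ℝ) α β]
        simp
        ring
      · rw [coeff_eq_zero_of_natDegree_lt ((natDegree_jacobi_le α β n).trans_lt hm),
          coeff_eq_zero_of_natDegree_lt ((natDegree_jacobi_le β α n).trans_lt hm)]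
        simp
    · rw [sub_eq_add_neg, ← neg_mul, ← C_neg, jacobiOp_add, jacobiOp_C_mul, jacobiOp_comp_neg,
        jacobiOp_jacobi, jacobiOp_jacobi]
      refine Polynomial.funext fun x => ?_
      simp [eval_comp]
      ring
  have := congrArg (fun q => q.eval x) (sub_eq_zero.1 hz)
  simpa [eval_comp] using this

theorem natDegree_jacobi_self {α : ℝ} (hα : -1 < α) (n : ℕ) :
    (jacobi α α n).natDegree = n := by
  refine le_antisymm (natDegree_jacobi_le _ _ _) (le_natDegree_of_ne_zero ?_)
  rw [coeff_jacobi_self]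
  rcases n.eq_zero_or_pos with rfl | hn
  · simp
  · have h1 : (1 : ℝ) ≤ n := by exact_mod_cast hn
    have := ascPochhammer_pos n ((n : ℝ) + α + α + 1) (by linarith)
    positivity

/-! ### The Gegenbauer weight and orthogonality -/

/-- One of 1 - x, 1 + x is at least 1, so its nonpositive power is at most 1 and the product is
bounded by the other factor. This separates the two endpoint singularities. -/
theorem weight_le {α x : ℝ} (hα : α ≤ 0) (hx : x ∈ Set.Ioo (-1 : ℝ) 1) :
    (1 - x ^ 2) ^ α ≤ (1 - x) ^ α + (1 + x) ^ α := by
  obtain ⟨h1, h2⟩ := hx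
  have e : 1 - x ^ 2 = (1 - x) * (1 + x) := by ring
  rw [e, Real.mul_rpow (by linarith) (by linarith)]
  have p1 : 0 < (1 - x) ^ α := Real.rpow_pos_of_pos (by linarith) _
  have p2 : 0 < (1 + x) ^ α := Real.rpow_pos_of_pos (by linarith) _
  rcases le_total 0 x with h | h
  · have := Real.rpow_le_one_of_one_le_of_nonpos (by linarith : 1 ≤ 1 + x) hα
    nlinarith
  · have := Real.rpow_le_one_of_one_le_of_nonpos (by linarith : 1 ≤ 1 - x) hα
    nlinarith

theorem weight_pos (α : ℝ) {x : ℝ} (hx : x ∈ Set.Ioo (-1 : ℝ) 1) : 0 < (1 - x ^ 2) ^ α :=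
  Real.rpow_pos_of_pos (by nlinarith [hx.1, hx.2]) _

theorem weight_intervalIntegrable {α : ℝ} (h1 : -1 < α) (h0 : α ≤ 0) :
    IntervalIntegrable (fun x : ℝ => (1 - x ^ 2) ^ α) volume (-1) 1 := by
  have hr : ∀ a b : ℝ, IntervalIntegrable (fun x : ℝ => x ^ α) volume a b := fun a b =>
    intervalIntegral.intervalIntegrable_rpow' h1
  have hl : IntervalIntegrable (fun x : ℝ => (1 - x) ^ α) volume (-1) 1 := by
    convert (hr 2 0).comp_sub_left 1 using 1 <;> norm_num
  have hr' : IntervalIntegrable (fun x : ℝ => (1 + x) ^ α) volume (-1) 1 := by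
    convert (hr 0 2).comp_add_right 1 using 1 <;> norm_num [add_comm]
  have hs := hl.add hr'
  rw [intervalIntegrable_iff_integrableOn_Ioo_of_le (by norm_num)] at hs ⊢
  refine Integrable.mono' hs
    (((measurable_id.pow_const 2).const_sub 1).pow_const α).aestronglyMeasurable ?_
  refine (ae_restrict_iff' measurableSet_Ioo).2 (Filter.Eventually.of_forall fun x hx => ?_)
  rw [Real.norm_of_nonneg (weight_pos α hx).le]
  exact weight_le h0 hx

theorem weight_mul_intervalIntegrable {α : ℝ} (h1 : -1 < α) (h0 : α ≤ 0) {f : ℝ → ℝ}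
    (hf : Continuous f) :
    IntervalIntegrable (fun x : ℝ => (1 - x ^ 2) ^ α * f x) volume (-1) 1 :=
  (weight_intervalIntegrable h1 h0).mul_continuousOn hf.continuousOn

/-- The integral of a polynomial against the Gegenbauer weight `(1-x²)^α`. -/
noncomputable def weightIntegral (α : ℝ) (p : ℝ[X]) : ℝ :=
  ∫ x in (-1 : ℝ)..1, (1 - x ^ 2) ^ α * p.eval x

theorem weightIntegral_add {α : ℝ} (h1 : -1 < α) (h0 : α ≤ 0)
    (p q : ℝ[X]) :
    weightIntegral α (p + q) = weightIntegral α p + weightIntegral α q := by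
  unfold weightIntegral
  rw [← intervalIntegral.integral_add (weight_mul_intervalIntegrable h1 h0 p.continuous)
    (weight_mul_intervalIntegrable h1 h0 q.continuous)]
  simp only [eval_add, mul_add]

theorem weightIntegral_C_mul (α : ℝ)
    (c : ℝ) (p : ℝ[X]) :
    weightIntegral α (C c * p) = c * weightIntegral α p := by
  unfold weightIntegral
  rw [← intervalIntegral.integral_const_mul]
  simp only [eval_mul, eval_C, mul_left_comm]

theorem weightIntegral_sum {α : ℝ} (h1 : -1 < α) (h0 : α ≤ 0)
    {ι : Type*} (s : Finset ι) (f : ι → ℝ[X]) :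
    weightIntegral α (∑ i ∈ s, f i) = ∑ i ∈ s, weightIntegral α (f i) := by
  classical
  induction s using Finset.induction_on with
  | empty => simp [weightIntegral]
  | insert i s hi ih => rw [Finset.sum_insert hi, Finset.sum_insert hi,
      weightIntegral_add h1 h0, ih]

/-- Self-adjointness of the Jacobi operator with respect to the weight. -/
theorem weightIntegral_jacobiOp_mul {α : ℝ} (h1 : -1 < α) (h0 : α ≤ 0)
    (p q : ℝ[X]) :
    weightIntegral α (jacobiOp α α q * p) = weightIntegral α (q * jacobiOp α α p) := by
  set f : ℝ[X] := jacobiOp α α q * p + C (-1) * (q * jacobiOp α α p) with hf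
  -- By Lagrange's identity, f times the weight is the derivative of (1-x²)^(α+1) g; the boundary
  -- terms vanish because α + 1 > 0.
  set g : ℝ[X] := derivative q * p - q * derivative p with hg
  have hd : ∀ x ∈ Set.Ioo (-1 : ℝ) 1,
      HasDerivAt (fun x : ℝ => (1 - x ^ 2) ^ (α + 1) * g.eval x)
        ((1 - x ^ 2) ^ α * f.eval x) x := by
    intro x hx
    have hpos : 0 < 1 - x ^ 2 := by nlinarith [hx.1, hx.2]
    have hb : HasDerivAt (fun x : ℝ => 1 - x ^ 2) (-(2 * x)) x := by
      simpa using (hasDerivAt_pow 2 x).const_sub 1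
    have := (hb.rpow_const (p := α + 1) (Or.inl hpos.ne')).mul (g.hasDerivAt x)
    refine this.congr_deriv ?_
    rw [add_sub_cancel_right, Real.rpow_add_one hpos.ne', hf, hg]
    simp [jacobiOp]
    ring
  have hc : ContinuousOn (fun x : ℝ => (1 - x ^ 2) ^ (α + 1) * g.eval x) (Set.Icc (-1) 1) := by
    refine ContinuousOn.mul (Continuous.continuousOn ?_) g.continuous.continuousOn
    exact (by fun_prop : Continuous fun x : ℝ => 1 - x ^ 2).rpow_const
      fun x => Or.inr (by linarith)
  have := intervalIntegral.integral_eq_sub_of_hasDerivAt_of_le (by norm_num) hc hd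
    (weight_mul_intervalIntegrable h1 h0 f.continuous)
  have hz : (0 : ℝ) ^ (α + 1) = 0 := Real.zero_rpow (by linarith)
  have h2 : weightIntegral α f = 0 := by
    unfold weightIntegral
    rw [this]
    norm_num [hz]
  rw [hf, weightIntegral_add h1 h0, weightIntegral_C_mul] at h2
  linarith

/-- The operator maps x^m to an eigenvalue multiple of x^m plus a multiple of x^(m-2). Moving it
onto the Jacobi polynomial leaves (n-m)(n+m+2α+1) times the integral equal to a lower moment, which
is zero by induction. -/
theorem weightIntegral_X_pow_mul_jacobi {α : ℝ} (h1 : -1 < α) (h0 : α ≤ 0)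
    {m n : ℕ} (hmn : m < n) :
    weightIntegral α (X ^ m * jacobi α α n) = 0 := by
  induction m using Nat.strong_induction_on with
  | _ m ih =>
  have h := weightIntegral_jacobiOp_mul h1 h0 (jacobi α α n) (X ^ m)
  -- For m < 2 the truncated exponent m - 2 is harmless, since its coefficient m(m-1) is zero.
  have e1 : jacobiOp α α (X ^ m) * jacobi α α n =
      C (m * (m - 1 : ℝ)) * (X ^ (m - 2) * jacobi α α n) +
        C (-(m * (m + 2 * α + 1))) * (X ^ m * jacobi α α n) := by
    refine Polynomial.funext fun x => ?_
    rcases m with _ | _ | m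
    · simp [jacobiOp]
    · simp [jacobiOp]; ring
    · simp [jacobiOp]; ring
  have e2 : X ^ m * jacobiOp α α (jacobi α α n) =
      C (-(n * (n + α + α + 1))) * (X ^ m * jacobi α α n) := by
    rw [jacobiOp_jacobi]; ring
  rw [e1, e2, weightIntegral_add h1 h0, weightIntegral_C_mul, weightIntegral_C_mul,
    weightIntegral_C_mul] at h
  have h3 : (m * (m - 1 : ℝ)) * weightIntegral α (X ^ (m - 2) * jacobi α α n) = 0 := by
    rcases m with _ | m
    · simp
    · rw [ih _ (by omega) (by omega), mul_zero]
  have hprod : ((n : ℝ) - m) * (n + m + 2 * α + 1) *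
      weightIntegral α (X ^ m * jacobi α α n) = 0 := by linear_combination h - h3
  have hn : (m : ℝ) + 1 ≤ n := by exact_mod_cast hmn
  have hm : (0 : ℝ) ≤ m := Nat.cast_nonneg _
  have hne : ((n : ℝ) - m) * (n + m + 2 * α + 1) ≠ 0 :=
    mul_ne_zero (by linarith) (by linarith)
  exact (mul_eq_zero.1 hprod).resolve_left hne

theorem weightIntegral_mul_jacobi {α : ℝ} (h1 : -1 < α) (h0 : α ≤ 0)
    {n : ℕ} {q : ℝ[X]} (hq : q.degree < n) :
    weightIntegral α (q * jacobi α α n) = 0 := by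
  by_cases hq0 : q = 0
  · simp [hq0, weightIntegral]
  rw [q.as_sum_range' n ((natDegree_lt_iff_degree_lt hq0).2 hq), Finset.sum_mul,
    weightIntegral_sum h1 h0]
  refine Finset.sum_eq_zero fun m hm => ?_
  rw [← C_mul_X_pow_eq_monomial, mul_assoc, weightIntegral_C_mul,
    weightIntegral_X_pow_mul_jacobi h1 h0 (Finset.mem_range.1 hm), mul_zero]

/-- A nonzero polynomial has finitely many zeros, so the nonnegative integrand is positive almost
everywhere. -/
theorem weightIntegral_pos {α : ℝ} (h1 : -1 < α) (h0 : α ≤ 0)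
    {p : ℝ[X]} (hp : p ≠ 0)
    (hnn : ∀ x ∈ Set.Ioo (-1 : ℝ) 1, 0 ≤ p.eval x) : 0 < weightIntegral α p := by
  unfold weightIntegral
  have hi := weight_mul_intervalIntegrable h1 h0 p.continuous
  rw [intervalIntegral.integral_of_le (by norm_num), integral_Ioc_eq_integral_Ioo]
  rw [intervalIntegrable_iff_integrableOn_Ioo_of_le (by norm_num)] at hi
  rw [setIntegral_pos_iff_support_of_nonneg_ae _ hi]
  · have hsub : Set.Ioo (-1 : ℝ) 1 \ (p.roots.toFinset : Set ℝ) ⊆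
        Function.support (fun x : ℝ => (1 - x ^ 2) ^ α * p.eval x) ∩ Set.Ioo (-1) 1 := by
      intro x hx
      refine ⟨mul_ne_zero (weight_pos α hx.1).ne' fun h => hx.2 ?_, hx.1⟩
      simpa [hp] using h
    refine lt_of_lt_of_le ?_ (measure_mono hsub)
    rw [measure_sdiff_null (Finset.measure_zero _ _)]
    simp
  · exact (ae_restrict_iff' measurableSet_Ioo).2 (Filter.Eventually.of_forall fun x hx =>
      mul_nonneg (weight_pos α hx).le (hnn x hx))

/-! ### Zeros of Jacobi polynomials and Gauss quadrature -/

theorem jacobi_self_ne_zero {α : ℝ} (h1 : -1 < α)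
    (n : ℕ) : jacobi α α n ≠ 0 := by
  rcases n.eq_zero_or_pos with rfl | hn
  · simp [jacobi]
  · intro h
    have := natDegree_jacobi_self h1 n
    rw [h, natDegree_zero] at this
    omega

/-- If P_n = h g, then g has degree below n and is orthogonal to P_n, while g P_n = h g² is
nonnegative and nonzero and so has positive integral. Multiple zeros, zeros outside (-1, 1) and
factors without real zeros are all excluded this way. -/
theorem not_dvd_jacobi_of_nonneg {α : ℝ} (h1 : -1 < α) (h0 : α ≤ 0)
    {n : ℕ} {h : ℝ[X]} (hd : 0 < h.natDegree)
    (hnn : ∀ x ∈ Set.Ioo (-1 : ℝ) 1, 0 ≤ h.eval x) : ¬ h ∣ jacobi α α n := by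
  rintro ⟨g, hg⟩
  have hne := jacobi_self_ne_zero h1 n
  have hh : h ≠ 0 := fun e => by simp [e] at hd
  have hg0 : g ≠ 0 := fun e => hne (by rw [hg, e, mul_zero])
  have hdeg := natDegree_jacobi_self h1 n
  rw [hg, natDegree_mul hh hg0] at hdeg
  have hz : weightIntegral α (g * jacobi α α n) = 0 :=
    weightIntegral_mul_jacobi h1 h0 ((natDegree_lt_iff_degree_lt hg0).1 (by omega))
  refine (weightIntegral_pos h1 h0 (mul_ne_zero hg0 hne) fun x hx => ?_).ne' hz
  rw [hg]
  simp only [eval_mul]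
  have := hnn x hx
  nlinarith [mul_nonneg this (mul_self_nonneg (g.eval x))]

theorem not_dvd_jacobi_of_nonpos {α : ℝ} (h1 : -1 < α) (h0 : α ≤ 0)
    {n : ℕ} {h : ℝ[X]} (hd : 0 < h.natDegree)
    (hnn : ∀ x ∈ Set.Ioo (-1 : ℝ) 1, h.eval x ≤ 0) : ¬ h ∣ jacobi α α n := fun hdvd =>
  not_dvd_jacobi_of_nonneg h1 h0 (h := -h) (by simpa using hd)
    (fun x hx => by simpa using hnn x hx) (by simpa using hdvd)

theorem card_gaussNodes {α : ℝ} (h1 : -1 < α) (h0 : α ≤ 0)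
    (n : ℕ) : (gaussNodes α n).card = n := by
  have hne := jacobi_self_ne_zero h1 n
  -- A multiple root r would yield the divisor (x - r)², which is nonnegative.
  have hnodup : (jacobi α α n).roots.Nodup := by
    refine Multiset.nodup_iff_count_le_one.2 fun r => ?_
    by_contra! hc
    rw [count_roots] at hc
    have hdvd := (pow_dvd_pow (X - C r) hc).trans (pow_rootMultiplicity_dvd _ r)
    refine not_dvd_jacobi_of_nonneg h1 h0 ?_ (fun x _ => ?_) hdvd
    · rw [natDegree_pow, natDegree_X_sub_C]; norm_num
    · rw [eval_pow]; exact sq_nonneg _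
  -- The cofactor q left after splitting off all real roots has no zero, hence constant sign by the
  -- intermediate value theorem, so it must be constant.
  obtain ⟨q, hq, hcard, hroots⟩ := exists_prod_multiset_X_sub_C_mul (jacobi α α n)
  have hq0 : q.natDegree = 0 := by
    by_contra hd
    have hd := Nat.pos_of_ne_zero hd
    have hdvd : q ∣ jacobi α α n := ⟨_, by rw [mul_comm]; exact hq.symm⟩
    have hnr : ∀ x, q.eval x ≠ 0 := fun x hx => by
      have : x ∈ q.roots := (mem_roots fun e => by simp [e] at hd).2 hx
      simp [hroots] at this
    by_cases hnn : ∀ x, 0 ≤ q.eval x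
    · exact not_dvd_jacobi_of_nonneg h1 h0 hd (fun x _ => hnn x) hdvd
    · push Not at hnn
      obtain ⟨y, hy⟩ := hnn
      refine not_dvd_jacobi_of_nonpos h1 h0 hd (fun x _ => ?_) hdvd
      by_contra! hx
      obtain ⟨z, hz⟩ := mem_range_of_exists_le_of_exists_ge q.continuous
        ⟨y, hy.le⟩ ⟨x, hx.le⟩
      exact hnr z hz
  rw [gaussNodes, Multiset.toFinset_card_of_nodup hnodup]
  rw [hq0, add_zero, natDegree_jacobi_self h1] at hcard
  exact hcard

theorem gaussNodes_subset {α : ℝ} (h1 : -1 < α) (h0 : α ≤ 0)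
    (n : ℕ) : ∀ x ∈ gaussNodes α n, x ∈ Set.Ioo (-1 : ℝ) 1 := by
  intro r hr
  have hne := jacobi_self_ne_zero h1 n
  have hdvd : X - C r ∣ jacobi α α n :=
    dvd_iff_isRoot.2 (isRoot_of_mem_roots (Multiset.mem_toFinset.1 hr))
  have hd : 0 < (X - C r).natDegree := by simp
  by_contra hout
  rw [Set.mem_Ioo, not_and_or, not_lt, not_lt] at hout
  rcases hout with h | h
  · exact not_dvd_jacobi_of_nonneg h1 h0 hd (fun x hx => by simp; linarith [hx.1]) hdvd
  · exact not_dvd_jacobi_of_nonpos h1 h0 hd (fun x hx => by simp; linarith [hx.2]) hdvd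

/-- The `Q`-point Gauss rule is exact for polynomials of degree less than `2 Q`. -/
theorem gaussSum_exact {α : ℝ} (h1 : -1 < α) (h0 : α ≤ 0)
    {Q : ℕ} {p : ℝ[X]} (hp : p.degree < (2 * Q : ℕ)) :
    gaussSum α Q (fun x => p.eval x) = weightIntegral α p := by
  set P := jacobi α α Q with hP
  have hne : P ≠ 0 := jacobi_self_ne_zero h1 Q
  have hdeg : P.degree = Q := by
    rw [degree_eq_natDegree hne, natDegree_jacobi_self h1]
  have hmod : (p % P).degree < Q := hdeg ▸ EuclideanDomain.mod_lt p hne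
  have hdiv : (p / P).degree < Q := by
    by_cases hz : p / P = 0
    · rw [hz, degree_zero]; exact WithBot.bot_lt_coe Q
    have hpz : p ≠ 0 := by rintro rfl; simp at hz
    have hle : P.degree ≤ p.degree := by
      by_contra! hlt
      exact hz ((Polynomial.div_eq_zero_iff hne).2 hlt)
    have hadd := degree_add_div hne hle
    rw [degree_eq_natDegree hne, degree_eq_natDegree hz, degree_eq_natDegree hpz, ← Nat.cast_add,
      Nat.cast_inj, natDegree_jacobi_self h1] at hadd
    have := (natDegree_lt_iff_degree_lt hpz).2 hp
    rw [← natDegree_lt_iff_degree_lt hz]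
    omega
  -- The quotient part is orthogonal to P. The remainder has degree below Q and agrees with p at the
  -- zeros of P, so it is the Lagrange interpolant of p.
  have hsplit : p = p / P * P + p % P := by
    rw [mul_comm]; exact (EuclideanDomain.div_add_mod p P).symm
  have hinterp : p % P = ∑ x ∈ gaussNodes α Q,
      C (p.eval x) * Lagrange.basis (gaussNodes α Q) id x := by
    have := Lagrange.eq_interpolate_of_eval_eq (s := gaussNodes α Q) (v := id) (f := p % P)
      (fun x => p.eval x) (Function.injective_id.injOn) (by rwa [card_gaussNodes h1 h0])
      (fun x hx => by
        have hx0 : P.eval x = 0 := isRoot_of_mem_roots (Multiset.mem_toFinset.1 hx)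
        conv_rhs => rw [hsplit]
        simp [hx0])
    rw [this, Lagrange.interpolate_apply]
  conv_rhs => rw [hsplit]
  rw [weightIntegral_add h1 h0, hP, weightIntegral_mul_jacobi h1 h0 hdiv, zero_add, ← hP, hinterp,
    weightIntegral_sum h1 h0]
  refine Finset.sum_congr rfl fun x _ => ?_
  rw [weightIntegral_C_mul, mul_comm]
  rfl

/-- The square of the Lagrange polynomial of x has degree 2Q - 2, so the rule integrates it exactly;
its value under the rule is the weight at x alone. -/
theorem gaussWeight_nonneg {α : ℝ} (h1 : -1 < α) (h0 : α ≤ 0)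
    {Q : ℕ} {x : ℝ} (hx : x ∈ gaussNodes α Q) :
    0 ≤ gaussWeight α Q x := by
  have hinj : Set.InjOn (id : ℝ → ℝ) (gaussNodes α Q) := Function.injective_id.injOn
  have hb : (Lagrange.basis (gaussNodes α Q) id x).natDegree = Q - 1 := by
    rw [natDegree_eq_of_degree_eq_some (Lagrange.degree_basis hinj hx), card_gaussNodes h1 h0]
  set ℓ := Lagrange.basis (gaussNodes α Q) id x with hℓ
  have hℓ0 : ℓ ≠ 0 := Lagrange.basis_ne_zero hinj hx
  have hQ : 0 < Q := by
    rw [← card_gaussNodes h1 h0 Q]; exact Finset.card_pos.2 ⟨x, hx⟩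
  have hsq : (ℓ * ℓ).degree < (2 * Q : ℕ) := by
    rw [← natDegree_lt_iff_degree_lt (mul_ne_zero hℓ0 hℓ0), natDegree_mul hℓ0 hℓ0, hb]
    omega
  have hex := gaussSum_exact h1 h0 hsq
  have hval : gaussSum α Q (fun y => (ℓ * ℓ).eval y) = gaussWeight α Q x := by
    unfold gaussSum
    rw [Finset.sum_eq_single_of_mem x hx]
    · have : ℓ.eval x = 1 := Lagrange.eval_basis_self hinj hx
      simp [this]
    · intro y hy hyx
      have : ℓ.eval y = 0 := Lagrange.eval_basis_of_ne (v := id) hyx.symm hy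
      simp [this]
  rw [← hval, hex]
  exact (weightIntegral_pos h1 h0 (mul_ne_zero hℓ0 hℓ0)
    fun y _ => by rw [eval_mul]; exact mul_self_nonneg _).le

/-- For Q > 0 this is exactness on the constant 1; the empty rule Q = 0 accounts for the inequality.
-/
theorem sum_gaussWeight_zero_le (Q : ℕ) : ∑ x ∈ gaussNodes 0 Q, gaussWeight 0 Q x ≤ 2 := by
  rcases Q.eq_zero_or_pos with rfl | hQ
  · have : gaussNodes 0 0 = ∅ := Finset.card_eq_zero.1 (card_gaussNodes (by norm_num) le_rfl 0)
    simp [this]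
  · have hd : (1 : ℝ[X]).degree < (2 * Q : ℕ) := by
      rw [degree_one]; exact_mod_cast (by omega : 0 < 2 * Q)
    have := gaussSum_exact (by norm_num) (le_refl (0 : ℝ)) hd
    simp only [gaussSum, weightIntegral, eval_one, mul_one, Real.rpow_zero,
      intervalIntegral.integral_const, smul_eq_mul] at this
    rw [this]; norm_num

/-- Error of the Gauss–Legendre rule in terms of the uniform distance to polynomials. -/
theorem abs_integral_sub_gaussSum_le {F : ℝ → ℝ} (hF : IntervalIntegrable F volume (-1) 1)
    {Q : ℕ} {p : ℝ[X]} {ε : ℝ} (hp : p.degree < (2 * Q : ℕ))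
    (h : ∀ s ∈ Set.Icc (-1 : ℝ) 1, |F s - p.eval s| ≤ ε) :
    |(∫ s in (-1 : ℝ)..1, F s) - gaussSum 0 Q F| ≤ 4 * ε := by
  have hε : 0 ≤ ε := (abs_nonneg _).trans (h 0 (by norm_num))
  have hex := gaussSum_exact (by norm_num) (le_refl (0 : ℝ)) hp
  simp only [weightIntegral, Real.rpow_zero, one_mul] at hex
  -- One half of 4ε comes from the length 2 of the interval, the other from nonnegative weights of
  -- total at most 2.
  have hI : |(∫ s in (-1 : ℝ)..1, F s) - ∫ s in (-1 : ℝ)..1, p.eval s| ≤ 2 * ε := by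
    rw [← intervalIntegral.integral_sub hF (p.continuous.intervalIntegrable _ _)]
    have := intervalIntegral.norm_integral_le_of_norm_le_const (a := -1) (b := 1) (C := ε)
      (f := fun s => F s - p.eval s) fun s hs => by
        rw [Set.uIoc_of_le (by norm_num)] at hs
        exact h s ⟨hs.1.le, hs.2⟩
    rw [Real.norm_eq_abs] at this
    refine this.trans (le_of_eq ?_)
    norm_num; ring
  have hS : |gaussSum 0 Q (fun s => p.eval s) - gaussSum 0 Q F| ≤ 2 * ε := by
    unfold gaussSum
    rw [← Finset.sum_sub_distrib]
    calc _ ≤ ∑ x ∈ gaussNodes 0 Q, |gaussWeight 0 Q x * p.eval x - gaussWeight 0 Q x * F x| :=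
          Finset.abs_sum_le_sum_abs _ _
      _ ≤ ∑ x ∈ gaussNodes 0 Q, gaussWeight 0 Q x * ε := by
          refine Finset.sum_le_sum fun x hx => ?_
          have hw := gaussWeight_nonneg (by norm_num) le_rfl hx
          have hm := gaussNodes_subset (by norm_num) le_rfl Q x hx
          rw [← mul_sub, abs_mul, abs_of_nonneg hw, abs_sub_comm]
          exact mul_le_mul_of_nonneg_left (h x (Set.Ioo_subset_Icc_self hm)) hw
      _ ≤ 2 * ε := by
          rw [← Finset.sum_mul]
          exact mul_le_mul_of_nonneg_right (sum_gaussWeight_zero_le Q) hε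
  rw [hex] at hS
  rw [abs_le] at *
  constructor <;> linarith

theorem tendsto_gaussSum {F : ℝ → ℝ} (hF : ContinuousOn F (Set.Icc (-1) 1)) :
    Filter.Tendsto (fun Q : ℕ => gaussSum 0 Q F) Filter.atTop
      (nhds (∫ s in (-1 : ℝ)..1, F s)) := by
  have hi : IntervalIntegrable F volume (-1) 1 :=
    hF.intervalIntegrable_of_Icc (by norm_num)
  refine Metric.tendsto_atTop.2 fun δ hδ => ?_
  -- The tolerance δ/8 makes the error bound 4 · δ/8 = δ/2 < δ.
  obtain ⟨p, hp⟩ := exists_polynomial_near_of_continuousOn (-1) 1 F hF (δ / 8) (by positivity)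
  refine ⟨p.natDegree + 1, fun Q hQ => ?_⟩
  rw [Real.dist_eq, abs_sub_comm]
  have := abs_integral_sub_gaussSum_le hi (Q := Q) (p := p) (ε := δ / 8)
    (lt_of_le_of_lt degree_le_natDegree (by exact_mod_cast (by omega : p.natDegree < 2 * Q)))
    fun s hs => by rw [abs_sub_comm]; exact (hp s hs).le
  linarith

/-! ### Riemann–Liouville derivatives under reflection and affine maps -/

theorem leftRL_eq {μ : ℝ} (h1 : μ < 1) (a : ℝ) (g : ℝ → ℝ) (x : ℝ) :
    leftRL a μ g x =
      1 / Real.Gamma (1 - μ) * deriv (fun y => ∫ s in a..y, g s / (y - s) ^ μ) x := by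
  have hf : ⌊μ⌋₊ = 0 := Nat.floor_eq_zero.2 h1
  simp [leftRL, hf]

theorem rightRL_eq {μ : ℝ} (h1 : μ < 1) (b : ℝ) (g : ℝ → ℝ) (x : ℝ) :
    rightRL b μ g x =
      -1 / Real.Gamma (1 - μ) * deriv (fun y => ∫ s in y..b, g s / (s - y) ^ μ) x := by
  have hf : ⌊μ⌋₊ = 0 := Nat.floor_eq_zero.2 h1
  simp [rightRL, hf]

/-- The substitution s ↦ -s exchanges the two fractional integrals, and the chain-rule sign matches
the sign in the right derivative. No differentiability of u is needed. -/
theorem leftRL_neg_one_eq {μ : ℝ} (h1 : μ < 1) (u : ℝ → ℝ) (x : ℝ) :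
    leftRL (-1) μ u x = rightRL 1 μ (fun t => u (-t)) (-x) := by
  rw [leftRL_eq h1, rightRL_eq h1]
  obtain ⟨G, hG⟩ : ∃ G : ℝ → ℝ, G = fun z => ∫ s in z..1, u (-s) / (s - z) ^ μ := ⟨_, rfl⟩
  have h : (fun y => ∫ s in (-1 : ℝ)..y, u s / (y - s) ^ μ) = fun y => G (-y) := by
    funext y
    rw [hG]
    have := intervalIntegral.integral_comp_neg (a := -y) (b := 1)
      (fun s => u s / (y - s) ^ μ)
    rw [neg_neg] at this
    rw [← this]
    simp only [sub_neg_eq_add, add_comm]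
  rw [h, deriv_comp_neg, ← hG]
  ring

/-- For z < 0 the real power is an exponential times a cosine that depends only on the exponent, so
a positive factor still splits off. Kernels can then be rescaled without restricting the integration
variable. -/
theorem mul_rpow_of_pos {h : ℝ} (hh : 0 < h) (z μ : ℝ) : (h * z) ^ μ = h ^ μ * z ^ μ := by
  rcases le_or_gt 0 z with hz | hz
  · exact Real.mul_rpow hh.le hz
  · rw [Real.rpow_def_of_neg (mul_neg_of_pos_of_neg hh hz), Real.rpow_def_of_neg hz,
      Real.rpow_def_of_pos hh, Real.log_mul hh.ne' hz.ne, add_mul, Real.exp_add]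
    ring

theorem toStd_eq {a b : ℝ} (hab : a < b) (x : ℝ) :
    toStd a b x = x / ((b - a) / 2) - (a / ((b - a) / 2) + 1) := by
  have : b - a ≠ 0 := by linarith
  unfold toStd
  field_simp
  ring

theorem deriv_comp_toStd {a b : ℝ} (hab : a < b) (G : ℝ → ℝ) (x : ℝ) :
    deriv (fun y => G (toStd a b y)) x = ((b - a) / 2)⁻¹ * deriv G (toStd a b x) := by
  obtain ⟨H, hH⟩ : ∃ H : ℝ → ℝ, H = fun w => G (w - (a / ((b - a) / 2) + 1)) := ⟨_, rfl⟩
  have h : (fun y => G (toStd a b y)) = fun y => H (((b - a) / 2)⁻¹ * y) := by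
    funext y
    rw [hH, toStd_eq hab, div_eq_inv_mul]
  rw [h, deriv_comp_mul_left, hH, deriv_comp_sub_const, toStd_eq hab, smul_eq_mul,
    div_eq_inv_mul x ((b - a) / 2)]

/-- With h = (b-a)/2, the substitution contributes h, the kernel h^(-μ) and the outer derivative
h^(-1). -/
theorem half_rpow_mul_inv {a b : ℝ} (hab : a < b) (μ : ℝ) :
    (b - a) / 2 / ((b - a) / 2) ^ μ * ((b - a) / 2)⁻¹ = (2 / (b - a)) ^ μ := by
  have hh : 0 < (b - a) / 2 := by linarith
  have e : 2 / (b - a) = ((b - a) / 2)⁻¹ := (inv_div _ _).symm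
  rw [e, Real.inv_rpow hh.le]
  have := (Real.rpow_pos_of_pos hh μ).ne'
  rw [div_mul_eq_mul_div, mul_inv_cancel₀ hh.ne', one_div]

theorem toStd_right {a b : ℝ} (hab : a < b) : toStd a b b = 1 := by
  have : b - a ≠ 0 := by linarith
  unfold toStd
  field_simp
  ring

theorem toStd_left (a b : ℝ) : toStd a b a = -1 := by simp [toStd]

theorem sub_eq_mul_toStd {a b : ℝ} (hab : a < b) (x y : ℝ) :
    x - y = (b - a) / 2 * (toStd a b x - toStd a b y) := by
  have : b - a ≠ 0 := by linarith
  unfold toStd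
  field_simp
  ring

theorem integral_comp_toStd {a b : ℝ} (hab : a < b) (f : ℝ → ℝ) (y z : ℝ) :
    ∫ x in y..z, f (toStd a b x) = (b - a) / 2 * ∫ t in toStd a b y..toStd a b z, f t := by
  have hh : (b - a) / 2 ≠ 0 := by linarith
  simp only [toStd_eq hab]
  rw [intervalIntegral.integral_comp_div_sub f hh, smul_eq_mul]

theorem rightRL_comp_toStd {a b μ : ℝ} (hab : a < b) (h1 : μ < 1) (u : ℝ → ℝ)
    (x : ℝ) : rightRL b μ (fun x => u (toStd a b x)) x =
      (2 / (b - a)) ^ μ * rightRL 1 μ u (toStd a b x) := by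
  rw [rightRL_eq h1, rightRL_eq h1]
  have hh : 0 < (b - a) / 2 := by linarith
  obtain ⟨G, hG⟩ : ∃ G : ℝ → ℝ, G = fun z => ∫ t in z..1, u t / (t - z) ^ μ := ⟨_, rfl⟩
  have h : (fun y => ∫ s in y..b, u (toStd a b s) / (s - y) ^ μ) =
      fun y => (b - a) / 2 / ((b - a) / 2) ^ μ * G (toStd a b y) := by
    funext y
    have e : ∀ t, u t / (((b - a) / 2) ^ μ * (t - toStd a b y) ^ μ) =
        (((b - a) / 2) ^ μ)⁻¹ * (u t / (t - toStd a b y) ^ μ) := fun t => by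
      rw [div_mul_eq_div_div_swap, div_eq_inv_mul]
    simp only [sub_eq_mul_toStd hab _ y, mul_rpow_of_pos hh]
    rw [integral_comp_toStd hab (fun t => u t / (((b - a) / 2) ^ μ * (t - toStd a b y) ^ μ)),
      toStd_right hab, hG]
    simp only [e, intervalIntegral.integral_const_mul]
    ring
  rw [h, deriv_const_mul_field, deriv_comp_toStd hab, ← half_rpow_mul_inv hab, ← hG]
  ring

theorem leftRL_comp_toStd {a b μ : ℝ} (hab : a < b) (h1 : μ < 1) (u : ℝ → ℝ)
    (x : ℝ) : leftRL a μ (fun x => u (toStd a b x)) x =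
      (2 / (b - a)) ^ μ * leftRL (-1) μ u (toStd a b x) := by
  rw [leftRL_eq h1, leftRL_eq h1]
  have hh : 0 < (b - a) / 2 := by linarith
  obtain ⟨G, hG⟩ : ∃ G : ℝ → ℝ, G = fun z => ∫ t in (-1 : ℝ)..z, u t / (z - t) ^ μ := ⟨_, rfl⟩
  have h : (fun y => ∫ s in a..y, u (toStd a b s) / (y - s) ^ μ) =
      fun y => (b - a) / 2 / ((b - a) / 2) ^ μ * G (toStd a b y) := by
    funext y
    have e : ∀ t, u t / (((b - a) / 2) ^ μ * (toStd a b y - t) ^ μ) =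
        (((b - a) / 2) ^ μ)⁻¹ * (u t / (toStd a b y - t) ^ μ) := fun t => by
      rw [div_mul_eq_div_div_swap, div_eq_inv_mul]
    simp only [sub_eq_mul_toStd hab y, mul_rpow_of_pos hh]
    rw [integral_comp_toStd hab (fun t => u t / (((b - a) / 2) ^ μ * (toStd a b y - t) ^ μ)),
      toStd_left, hG]
    simp only [e, intervalIntegral.integral_const_mul]
    ring
  rw [h, deriv_const_mul_field, deriv_comp_toStd hab, ← half_rpow_mul_inv hab, ← hG]
  ring

/-! ### Riemann–Liouville derivatives of powers and Legendre polynomials -/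

/-- This is the scaled Beta integral B(k+1, 1-μ), transferred from the complex to the real setting.
-/
theorem integral_pow_div_rpow (k : ℕ) {μ c : ℝ} (hμ : μ < 1) (hc : 0 < c) :
    ∫ x in (0 : ℝ)..c, x ^ k / (c - x) ^ μ =
      Real.Gamma (k + 1) * Real.Gamma (1 - μ) / Real.Gamma (k + 1 - μ + 1) *
        c ^ (k + 1 - μ) := by
  apply Complex.ofReal_injective
  have hs := Complex.betaIntegral_scaled (k + 1 : ℝ) (1 - μ : ℝ) hc
  rw [Complex.betaIntegral_eq_Gamma_mul_div _ _
    (by rw [Complex.ofReal_re]; positivity) (by rw [Complex.ofReal_re]; linarith),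
    ← Complex.ofReal_add, Complex.Gamma_ofReal, Complex.Gamma_ofReal, Complex.Gamma_ofReal] at hs
  rw [← intervalIntegral.integral_ofReal]
  have e : (k + 1 : ℝ) + (1 - μ) = k + 1 - μ + 1 := by ring
  rw [e] at hs
  have e2 : (((k + 1 - μ + 1 : ℝ) : ℂ) - 1) = ((k + 1 - μ : ℝ) : ℂ) := by push_cast; ring
  rw [e2, ← Complex.ofReal_cpow hc.le] at hs
  have hl : ∫ x in (0 : ℝ)..c, ((x ^ k / (c - x) ^ μ : ℝ) : ℂ) =
      ∫ x in (0 : ℝ)..c, (x : ℂ) ^ (((k + 1 : ℝ) : ℂ) - 1) *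
        ((c : ℂ) - x) ^ (((1 - μ : ℝ) : ℂ) - 1) := by
    refine intervalIntegral.integral_congr fun x hx => ?_
    rw [Set.uIcc_of_le hc.le] at hx
    have hx2 : 0 ≤ c - x := by linarith [hx.2]
    have e3 : (((1 - μ : ℝ) : ℂ) - 1) = ((-μ : ℝ) : ℂ) := by push_cast; ring
    have e4 : (((k + 1 : ℝ) : ℂ) - 1) = (k : ℂ) := by push_cast; ring
    simp only [e3, e4]
    rw [Complex.cpow_natCast, ← Complex.ofReal_sub, ← Complex.ofReal_cpow hx2,
      Real.rpow_neg hx2]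
    push_cast
    rw [div_eq_mul_inv]
  rw [hl, hs]
  push_cast
  ring

theorem Gamma_mul_ascPochhammer {z : ℝ} (hz : 0 < z) (m : ℕ) :
    Real.Gamma z * (ascPochhammer ℝ m).eval z = Real.Gamma (z + m) := by
  induction m with
  | zero => simp
  | succ m ih =>
    have h : z + m ≠ 0 := by positivity
    rw [ascPochhammer_succ_eval, ← mul_assoc, ih, Nat.cast_succ, ← add_assoc,
      Real.Gamma_add_one h, mul_comm]

/-- The right fractional integral of order `1 - μ` of `u` on `(·, 1)`, up to its Gamma factor,
is differentiable at `x`, and the Riemann–Liouville derivative of order `μ` of `u` is `d`. -/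
def HasRightRL (μ : ℝ) (u : ℝ → ℝ) (x d : ℝ) : Prop :=
  HasDerivAt (fun y => ∫ s in y..1, u s / (s - y) ^ μ) (-(Real.Gamma (1 - μ) * d)) x

theorem HasRightRL.rightRL_eq {μ x d : ℝ} {u : ℝ → ℝ} (h : HasRightRL μ u x d) (h1 : μ < 1) :
    rightRL 1 μ u x = d := by
  have hg : Real.Gamma (1 - μ) ≠ 0 := (Real.Gamma_pos_of_pos (by linarith)).ne'
  rw [StiffnessMatrix.rightRL_eq h1, HasDerivAt.deriv h]
  field_simp

theorem intervalIntegrable_div_rpow {μ : ℝ} (h1 : μ < 1) {u : ℝ → ℝ} (hu : Continuous u) {y : ℝ}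
    (hy : y ≤ 1) : IntervalIntegrable (fun s => u s / (s - y) ^ μ) volume y 1 := by
  have hr : IntervalIntegrable (fun s : ℝ => (s - y) ^ (-μ)) volume y 1 := by
    convert (intervalIntegral.intervalIntegrable_rpow' (a := 0) (b := 1 - y)
      (by linarith : -1 < -μ)).comp_sub_right y using 1 <;> ring
  refine (hr.continuousOn_mul hu.continuousOn).congr fun s hs => ?_
  rw [Set.uIoc_of_le hy] at hs
  rw [Real.rpow_neg (by linarith [hs.1]), div_eq_mul_inv]

theorem HasRightRL.add {μ x d e : ℝ} {u v : ℝ → ℝ} (h1 : μ < 1) (hx : x < 1)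
    (hu : Continuous u) (hv : Continuous v) (hd : HasRightRL μ u x d) (he : HasRightRL μ v x e) :
    HasRightRL μ (fun t => u t + v t) x (d + e) := by
  unfold HasRightRL at *
  have hs := HasDerivAt.add hd he
  have e1 : -(Real.Gamma (1 - μ) * d) + -(Real.Gamma (1 - μ) * e) =
    -(Real.Gamma (1 - μ) * (d + e)) := by ring
  rw [e1] at hs
  refine hs.congr_of_eventuallyEq ?_
  -- Integrability of the kernel is available for y ≤ 1, so the integral is split only in a
  -- neighbourhood of x < 1.
  filter_upwards [Iio_mem_nhds hx] with y hy
  rw [Pi.add_apply, ← intervalIntegral.integral_add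
    (intervalIntegrable_div_rpow h1 hu (le_of_lt hy))
    (intervalIntegrable_div_rpow h1 hv (le_of_lt hy))]
  simp only [add_div]

theorem HasRightRL.const_mul {μ x d : ℝ} {u : ℝ → ℝ} (c : ℝ) (hd : HasRightRL μ u x d) :
    HasRightRL μ (fun t => c * u t) x (c * d) := by
  unfold HasRightRL at *
  have hs := HasDerivAt.const_mul c hd
  have e1 : c * -(Real.Gamma (1 - μ) * d) = -(Real.Gamma (1 - μ) * (c * d)) := by ring
  rw [e1] at hs
  simpa only [← intervalIntegral.integral_const_mul, mul_div_assoc] using hs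

theorem HasRightRL.sum {μ x : ℝ} {ι : Type*} (s : Finset ι) {u : ι → ℝ → ℝ} {d : ι → ℝ}
    (h1 : μ < 1) (hx : x < 1) (hu : ∀ i, Continuous (u i))
    (hd : ∀ i, HasRightRL μ (u i) x (d i)) :
    HasRightRL μ (fun t => ∑ i ∈ s, u i t) x (∑ i ∈ s, d i) := by
  classical
  induction s using Finset.induction_on with
  | empty => simp [HasRightRL, hasDerivAt_const]
  | insert i s hi ih =>
    simp only [Finset.sum_insert hi]
    exact (hd i).add h1 hx (hu i) (continuous_finsetSum _ fun j _ => hu j) ih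

theorem hasRightRL_pow (k : ℕ) {μ x : ℝ} (h1 : μ < 1) (hx : x < 1) :
    HasRightRL μ (fun t => (1 - t) ^ k) x
      (Real.Gamma (k + 1) / Real.Gamma (k + 1 - μ) * ((1 - x) ^ k * (1 - x) ^ (-μ))) := by
  unfold HasRightRL
  have hk : (0 : ℝ) ≤ k := Nat.cast_nonneg k
  have hx' : 0 < 1 - x := by linarith
  set K := Real.Gamma (k + 1) * Real.Gamma (1 - μ) / Real.Gamma (k + 1 - μ + 1) with hK
  have hder : HasDerivAt (fun y : ℝ => K * (1 - y) ^ (k + 1 - μ))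
      (K * (-1 * (k + 1 - μ) * (1 - x) ^ (k + 1 - μ - 1))) x :=
    (((hasDerivAt_id x).const_sub 1).rpow_const (Or.inl hx'.ne')).const_mul K
  have hg : Real.Gamma (k + 1 - μ) ≠ 0 := (Real.Gamma_pos_of_pos (by linarith)).ne'
  have hkμ : (k : ℝ) + 1 - μ ≠ 0 := by linarith
  have he : K * (-1 * (k + 1 - μ) * (1 - x) ^ (k + 1 - μ - 1)) = -(Real.Gamma (1 - μ) *
      (Real.Gamma (k + 1) / Real.Gamma (k + 1 - μ) * ((1 - x) ^ k * (1 - x) ^ (-μ)))) := by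
    rw [hK, Real.Gamma_add_one hkμ, ← Real.rpow_natCast (1 - x) k, ← Real.rpow_add hx']
    have e : (k : ℝ) + 1 - μ - 1 = k + -μ := by ring
    rw [e]
    field_simp
  rw [← he]
  refine hder.congr_of_eventuallyEq ?_
  filter_upwards [Iio_mem_nhds hx] with y hy
  rw [hK, ← integral_pow_div_rpow k h1 (sub_pos.2 hy)]
  have := intervalIntegral.integral_comp_sub_left (a := y) (b := 1)
    (fun t => t ^ k / (1 - y - t) ^ μ) 1
  rw [sub_self] at this
  rw [← this]
  refine intervalIntegral.integral_congr fun s _ => ?_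
  congr 2
  ring

/-- The right Riemann–Liouville derivative of the Legendre polynomial `P_n` in closed form. -/
noncomputable def rightLegendre (μ : ℝ) (n : ℕ) (x : ℝ) : ℝ :=
  Real.Gamma (n + 1) / Real.Gamma (n - μ + 1) * (jacobi (-μ) μ n).eval x * (1 - x) ^ (-μ)

/-- The left Riemann–Liouville derivative of the Legendre polynomial `P_n` in closed form. -/
noncomputable def leftLegendre (μ : ℝ) (n : ℕ) (x : ℝ) : ℝ :=
  Real.Gamma (n + 1) / Real.Gamma (n - μ + 1) * (jacobi μ (-μ) n).eval x * (1 + x) ^ (-μ)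

/-- Both parameter pairs sum to zero, so the factor (n+1)_k is common. What remains is
Γ(k+1)(k+1)_{n-k} = Γ(n+1) together with Γ(k+1-μ)(k+1-μ)_{n-k} = Γ(n-μ+1). -/
theorem jacobiCoeff_zero_mul_Gamma {μ : ℝ} (h1 : μ < 1) {n k : ℕ} (hk : k ≤ n) :
    jacobiCoeff 0 0 n k * (Real.Gamma (k + 1) / Real.Gamma (k + 1 - μ)) =
      Real.Gamma (n + 1) / Real.Gamma (n - μ + 1) * jacobiCoeff (-μ) μ n k := by
  have hk0 : (0 : ℝ) ≤ k := Nat.cast_nonneg k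
  have hkn : (k : ℝ) ≤ n := by exact_mod_cast hk
  have e1 := Gamma_mul_ascPochhammer (by linarith : (0 : ℝ) < k + 1) (n - k)
  have e2 := Gamma_mul_ascPochhammer (by linarith : (0 : ℝ) < k + 1 - μ) (n - k)
  have c1 : (k : ℝ) + 1 + (n - k : ℕ) = n + 1 := by push_cast [hk]; ring
  have c2 : (k : ℝ) + 1 - μ + (n - k : ℕ) = n - μ + 1 := by push_cast [hk]; ring
  rw [c1] at e1
  rw [c2] at e2
  have hg1 : Real.Gamma (k + 1 - μ) ≠ 0 := (Real.Gamma_pos_of_pos (by linarith)).ne'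
  have hg2 : Real.Gamma (n - μ + 1) ≠ 0 := (Real.Gamma_pos_of_pos (by linarith)).ne'
  unfold jacobiCoeff
  have d1 : (0 : ℝ) + k + 1 = k + 1 := by ring
  have d2 : -μ + (k : ℝ) + 1 = k + 1 - μ := by ring
  have d3 : (n : ℝ) + 0 + 0 + 1 = n + 1 := by ring
  have d4 : (n : ℝ) + -μ + μ + 1 = n + 1 := by ring
  rw [d1, d2, d3, d4, ← e1, ← e2]
  have hB := right_ne_zero_of_mul (e2.trans_ne hg2)
  field_simp

theorem hasRightRL_legendre (n : ℕ) {μ x : ℝ} (h1 : μ < 1) (hx : x < 1) :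
    HasRightRL μ (fun t => (legendre n).eval t) x (rightLegendre μ n x) := by
  have hs := HasRightRL.sum (μ := μ) (x := x) (Finset.range (n + 1)) h1 hx
    (u := fun k t => jacobiCoeff 0 0 n k * (-1 / 2) ^ k * (1 - t) ^ k) (fun k => by fun_prop)
    (fun k => (hasRightRL_pow k h1 hx).const_mul _)
  convert hs using 1
  · funext t
    rw [legendre, jacobi_eval]
    refine Finset.sum_congr rfl fun k _ => ?_
    rw [mul_assoc, ← mul_pow]
    congr 2
    ring
  · rw [rightLegendre, jacobi_eval, Finset.mul_sum, Finset.sum_mul]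
    refine Finset.sum_congr rfl fun k hk => ?_
    have hc := jacobiCoeff_zero_mul_Gamma h1 (Nat.lt_succ_iff.1 (Finset.mem_range.1 hk))
    have hp : ((x - 1) / 2) ^ k = (-1 / 2) ^ k * (1 - x) ^ k := by
      rw [← mul_pow]; congr 1; ring
    rw [hp]
    linear_combination (-(-1 / 2) ^ k * (1 - x) ^ k * (1 - x) ^ (-μ)) * hc

theorem legendre_eval_neg (n : ℕ) (x : ℝ) :
    (legendre n).eval (-x) = (-1) ^ n * (legendre n).eval x :=
  jacobi_eval_neg (by norm_num) n x

theorem rightLegendre_neg (μ : ℝ) (n : ℕ) (x : ℝ) :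
    rightLegendre μ n (-x) = (-1) ^ n * leftLegendre μ n x := by
  rw [rightLegendre, leftLegendre, jacobi_eval_neg (by norm_num), sub_neg_eq_add]
  ring

theorem rightRL_legendre_comb {μ x : ℝ} (h1 : μ < 1) (hx : x < 1) (c d : ℝ)
    (m n : ℕ) :
    rightRL 1 μ (fun t => c * (legendre m).eval t + d * (legendre n).eval t) x =
      c * rightLegendre μ m x + d * rightLegendre μ n x :=
  (((hasRightRL_legendre m h1 hx).const_mul c).add h1 hx (by fun_prop) (by fun_prop)
    ((hasRightRL_legendre n h1 hx).const_mul d)).rightRL_eq h1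

theorem leftRL_legendre_comb {μ x : ℝ} (h1 : μ < 1) (hx : -1 < x) (c d : ℝ)
    (m n : ℕ) :
    leftRL (-1) μ (fun t => c * (legendre m).eval t + d * (legendre n).eval t) x =
      c * leftLegendre μ m x + d * leftLegendre μ n x := by
  rw [leftRL_neg_one_eq h1]
  simp only [legendre_eval_neg, ← mul_assoc]
  rw [rightRL_legendre_comb h1 (by linarith), rightLegendre_neg, rightLegendre_neg]
  have hm : ((-1 : ℝ) ^ m) * (-1) ^ m = 1 := by rw [← mul_pow]; norm_num
  have hn : ((-1 : ℝ) ^ n) * (-1) ^ n = 1 := by rw [← mul_pow]; norm_num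
  linear_combination c * leftLegendre μ m x * hm + d * leftLegendre μ n x * hn

theorem rightRL_legendre {μ x : ℝ} (h1 : μ < 1) (hx : x < 1) (n : ℕ) :
    rightRL 1 μ (fun t => (legendre n).eval t) x = rightLegendre μ n x :=
  (hasRightRL_legendre n h1 hx).rightRL_eq h1

theorem leftRL_legendre {μ x : ℝ} (h1 : μ < 1) (hx : -1 < x) (n : ℕ) :
    leftRL (-1) μ (fun t => (legendre n).eval t) x = leftLegendre μ n x := by
  simpa using leftRL_legendre_comb h1 hx 1 0 n n

/-! ### Pairings of fractional derivatives -/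

theorem intervalIntegrable_comp_affine {f : ℝ → ℝ} {c d A B : ℝ} (hc : c ≠ 0)
    (hf : IntervalIntegrable f volume (c * A + d) (c * B + d)) :
    IntervalIntegrable (fun x => f (c * x + d)) volume A B := by
  have h := (hf.comp_add_right d).comp_mul_left (c := c)
  simpa [hc] using h

theorem intervalIntegrable_comp_toStd {a b : ℝ} (hab : a < b) {f : ℝ → ℝ}
    (hf : IntervalIntegrable f volume (-1) 1) :
    IntervalIntegrable (fun x => f (toStd a b x)) volume a b := by
  have hb : b - a ≠ 0 := by linarith
  have e : ∀ x, toStd a b x = 2 / (b - a) * x + (-1 - 2 * a / (b - a)) := fun x => by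
    unfold toStd; ring
  simp only [e]
  refine intervalIntegrable_comp_affine (div_ne_zero two_ne_zero hb) ?_
  rw [← e, ← e, toStd_left, toStd_right hab]
  exact hf

theorem toStd_mem_Ioo {a b x : ℝ} (hx : x ∈ Set.Ioo a b) : toStd a b x ∈ Set.Ioo (-1 : ℝ) 1 := by
  obtain ⟨h1, h2⟩ := hx
  have hb : 0 < b - a := by linarith
  have h3 : 0 < (x - a) / (b - a) := div_pos (by linarith) hb
  have h4 : (x - a) / (b - a) < 1 := (div_lt_one hb).2 (by linarith)
  unfold toStd
  rw [mul_div_assoc]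
  constructor <;> linarith

/-- The pairing of the fractional derivatives of `P_n` and `P_r` in closed form. -/
noncomputable def legendrePairing (μ : ℝ) (r n : ℕ) : ℝ :=
  Real.Gamma (r + 1) / Real.Gamma (r - μ + 1) * (Real.Gamma (n + 1) / Real.Gamma (n - μ + 1)) *
    jacobiIntegral μ r n

/-- The integrand of `legendrePairing`. -/
noncomputable def legendreKernel (μ : ℝ) (r n : ℕ) (x : ℝ) : ℝ :=
  Real.Gamma (r + 1) / Real.Gamma (r - μ + 1) * (Real.Gamma (n + 1) / Real.Gamma (n - μ + 1)) *
    ((1 - x ^ 2) ^ (-μ) * ((jacobi (-μ) μ r).eval x * (jacobi μ (-μ) n).eval x))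

theorem integral_legendreKernel (μ : ℝ) (r n : ℕ) :
    ∫ x in (-1 : ℝ)..1, legendreKernel μ r n x = legendrePairing μ r n := by
  simp only [legendreKernel, legendrePairing, jacobiIntegral, intervalIntegral.integral_const_mul]

theorem leftLegendre_mul_rightLegendre (μ : ℝ) (r n : ℕ) {x : ℝ} (hx : x ∈ Set.Ioo (-1 : ℝ) 1) :
    leftLegendre μ n x * rightLegendre μ r x = legendreKernel μ r n x := by
  have e : 1 - x ^ 2 = (1 - x) * (1 + x) := by ring
  rw [leftLegendre, rightLegendre, legendreKernel, e,
    Real.mul_rpow (by linarith [hx.2]) (by linarith [hx.1])]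
  ring

theorem jacobiIntegrand_intervalIntegrable {μ : ℝ} (h0 : 0 < μ) (h1 : μ < 1) (r n : ℕ) :
    IntervalIntegrable (fun x : ℝ => (1 - x ^ 2) ^ (-μ) *
      ((jacobi (-μ) μ r).eval x * (jacobi μ (-μ) n).eval x)) volume (-1) 1 :=
  weight_mul_intervalIntegrable (by linarith) (by linarith) (by fun_prop)

theorem legendreKernel_intervalIntegrable {μ : ℝ} (h0 : 0 < μ) (h1 : μ < 1) (r n : ℕ) :
    IntervalIntegrable (legendreKernel μ r n) volume (-1) 1 :=
  (jacobiIntegrand_intervalIntegrable h0 h1 r n).const_mul _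

theorem fracPairing_legendre {μ : ℝ} (h1 : μ < 1) (r n : ℕ) :
    fracPairing (-1) 1 μ (fun ξ => (legendre n).eval ξ) (fun ξ => (legendre r).eval ξ) =
      legendrePairing μ r n := by
  rw [fracPairing, ← integral_legendreKernel]
  -- The closed forms of both derivatives are available together only at interior points; the
  -- endpoints are negligible.
  refine intervalIntegral.integral_congr_Ioo_of_le (by norm_num) fun x hx => ?_
  rw [leftRL_legendre h1 hx.1, rightRL_legendre h1 hx.2, leftLegendre_mul_rightLegendre μ r n hx]

/-- The integrand of the pairing of two scaled Legendre differences on `[-1, 1]`. -/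
noncomputable def differenceKernel (μ c d : ℝ) (r n : ℕ) (x : ℝ) : ℝ :=
  c * d * (legendreKernel μ (r + 2) (n + 2) x - legendreKernel μ (r + 2) n x
    - legendreKernel μ r (n + 2) x + legendreKernel μ r n x)

theorem differenceKernel_intervalIntegrable {μ : ℝ} (h0 : 0 < μ) (h1 : μ < 1) (c d : ℝ)
    (r n : ℕ) : IntervalIntegrable (differenceKernel μ c d r n) volume (-1) 1 :=
  ((((legendreKernel_intervalIntegrable h0 h1 _ _).sub
    (legendreKernel_intervalIntegrable h0 h1 _ _)).sub
    (legendreKernel_intervalIntegrable h0 h1 _ _)).add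
    (legendreKernel_intervalIntegrable h0 h1 _ _)).const_mul _

theorem integral_differenceKernel {μ : ℝ} (h0 : 0 < μ) (h1 : μ < 1) (c d : ℝ) (r n : ℕ) :
    ∫ x in (-1 : ℝ)..1, differenceKernel μ c d r n x =
      c * d * (legendrePairing μ (r + 2) (n + 2) - legendrePairing μ (r + 2) n
        - legendrePairing μ r (n + 2) + legendrePairing μ r n) := by
  have hi := legendreKernel_intervalIntegrable h0 h1
  simp only [differenceKernel, ← integral_legendreKernel]
  rw [intervalIntegral.integral_const_mul, intervalIntegral.integral_add
    (((hi _ _).sub (hi _ _)).sub (hi _ _)) (hi _ _), intervalIntegral.integral_sub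
    ((hi _ _).sub (hi _ _)) (hi _ _), intervalIntegral.integral_sub (hi _ _) (hi _ _)]

/-- A scaled difference of Legendre polynomials, transported to `[a, b]`. -/
noncomputable def differenceFn (a b c : ℝ) (n : ℕ) (x : ℝ) : ℝ :=
  c * ((legendre (n + 2)).eval (toStd a b x) - (legendre n).eval (toStd a b x))

theorem trialFn_succ (a b : ℝ) (n : ℕ) :
    trialFn a b (n + 1) = differenceFn a b (trialCoeff (n + 1)) n := rfl

theorem testFn_succ (a b : ℝ) (n : ℕ) :
    testFn a b (n + 1) = differenceFn a b (testCoeff (n + 1)) n := rfl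

theorem leftRL_mul_rightRL_difference {a b μ : ℝ} (hab : a < b) (h1 : μ < 1)
    (c d : ℝ) (r n : ℕ) {x : ℝ} (hx : x ∈ Set.Ioo a b) :
    leftRL a μ (differenceFn a b c n) x * rightRL b μ (differenceFn a b d r) x =
      (2 / (b - a)) ^ (2 * μ) * differenceKernel μ c d r n (toStd a b x) := by
  have hξ := toStd_mem_Ioo hx
  obtain ⟨U, hU⟩ : ∃ U : ℝ → ℕ → ℝ → ℝ, U = fun c n t =>
      c * (legendre (n + 2)).eval t + -c * (legendre n).eval t := ⟨_, rfl⟩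
  have e : ∀ (c : ℝ) (n : ℕ), differenceFn a b c n = fun x => U c n (toStd a b x) := by
    intro c n
    funext x
    rw [hU, differenceFn]
    ring
  rw [e, e, leftRL_comp_toStd hab h1, rightRL_comp_toStd hab h1, hU,
    leftRL_legendre_comb h1 hξ.1, rightRL_legendre_comb h1 hξ.2, differenceKernel]
  simp only [← leftLegendre_mul_rightLegendre μ _ _ hξ]
  rw [two_mul, Real.rpow_add (div_pos two_pos (sub_pos.2 hab))]
  ring

theorem difference_intervalIntegrable {a b μ : ℝ} (hab : a < b) (h0 : 0 < μ) (h1 : μ < 1)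
    (c d : ℝ) (r n : ℕ) :
    IntervalIntegrable (fun x => leftRL a μ (differenceFn a b c n) x *
      rightRL b μ (differenceFn a b d r) x) volume a b := by
  refine ((intervalIntegrable_comp_toStd hab
    (differenceKernel_intervalIntegrable h0 h1 c d r n)).const_mul
      ((2 / (b - a)) ^ (2 * μ))).congr_uIoo fun x hx => ?_
  rw [Set.uIoo_of_le hab.le] at hx
  exact (leftRL_mul_rightRL_difference hab h1 c d r n hx).symm

/-- The modal pairing at order `μ`, with the Jacobian of the map of `[a, b]` onto `[-1, 1]`. -/
noncomputable def orderKernel (a b : ℝ) (r n : ℕ) (μ : ℝ) : ℝ :=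
  (2 / (b - a)) ^ (2 * μ - 1) * legendrePairing μ r n

theorem fracPairing_difference {a b μ : ℝ} (hab : a < b) (h0 : 0 < μ) (h1 : μ < 1)
    (c d : ℝ) (r n : ℕ) :
    fracPairing a b μ (differenceFn a b c n) (differenceFn a b d r) =
      c * d * (orderKernel a b (r + 2) (n + 2) μ - orderKernel a b (r + 2) n μ
        - orderKernel a b r (n + 2) μ + orderKernel a b r n μ) := by
  rw [fracPairing, intervalIntegral.integral_congr_Ioo_of_le hab.le fun x hx =>
    leftRL_mul_rightRL_difference hab h1 c d r n hx, intervalIntegral.integral_const_mul,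
    integral_comp_toStd hab, toStd_left, toStd_right hab, integral_differenceKernel h0 h1]
  -- The Jacobian (b-a)/2 lowers the exponent from 2μ to 2μ - 1.
  have hb : 0 < b - a := sub_pos.2 hab
  simp only [orderKernel, Real.rpow_sub_one (div_pos two_pos hb).ne']
  field_simp

/-! ### Parity of the modal pairing and continuity in the order -/

theorem jacobiIntegral_symm (μ : ℝ) (r n : ℕ) :
    jacobiIntegral μ r n = (-1) ^ (r + n) * jacobiIntegral μ n r := by
  unfold jacobiIntegral
  have h := intervalIntegral.integral_comp_neg (a := -1) (b := 1) (fun ξ : ℝ =>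
    (1 - ξ ^ 2) ^ (-μ) * ((jacobi (-μ) μ r).eval ξ * (jacobi μ (-μ) n).eval ξ))
  rw [neg_neg] at h
  rw [← h, ← intervalIntegral.integral_const_mul]
  refine intervalIntegral.integral_congr fun x _ => ?_
  rw [jacobi_eval_neg (by norm_num), jacobi_eval_neg (by norm_num), neg_sq, pow_add]
  ring

theorem orderKernel_symm (a b : ℝ) (r n : ℕ) (μ : ℝ) :
    orderKernel a b r n μ = (-1) ^ (r + n) * orderKernel a b n r μ := by
  rw [orderKernel, orderKernel, legendrePairing, legendrePairing, jacobiIntegral_symm μ r n]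
  ring

theorem continuous_ascPochhammer_eval (k : ℕ) {X : Type*} [TopologicalSpace X] {f : X → ℝ}
    (hf : Continuous f) : Continuous fun x => (ascPochhammer ℝ k).eval (f x) :=
  (ascPochhammer ℝ k).continuous.comp hf

theorem continuous_jacobi_eval {X : Type*} [TopologicalSpace X] {f g h : X → ℝ} (n : ℕ)
    (hf : Continuous f) (hg : Continuous g) (hh : Continuous h) :
    Continuous fun x => (jacobi (f x) (g x) n).eval (h x) := by
  simp only [jacobi_eval, jacobiCoeff]
  refine continuous_finsetSum _ fun k _ => ?_
  have h1 := continuous_ascPochhammer_eval k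
    (f := fun x => (n : ℝ) + f x + g x + 1) (by fun_prop)
  have h2 := continuous_ascPochhammer_eval (n - k) (f := fun x => f x + k + 1) (by fun_prop)
  fun_prop

/-- Dominated convergence: since 0 < 1 - x² ≤ 1 inside the interval, (1-x²)^(-hi) dominates all the
weights, and it is integrable because hi < 1. The polynomial factors are bounded by compactness.
Continuity keeps the product with a merely integrable order weight integrable. -/
theorem continuousOn_jacobiIntegral {lo hi : ℝ} (h0 : 0 < lo) (h1 : hi < 1) (r n : ℕ) :
    ContinuousOn (fun μ => jacobiIntegral μ r n) (Set.Icc lo hi) := by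
  intro μ₀ hμ₀
  have hlh : lo ≤ hi := hμ₀.1.trans hμ₀.2
  have hcont : Continuous fun p : ℝ × ℝ =>
      (jacobi (-p.1) p.1 r).eval p.2 * (jacobi p.1 (-p.1) n).eval p.2 :=
    (continuous_jacobi_eval r (by fun_prop) (by fun_prop) (by fun_prop)).mul
      (continuous_jacobi_eval n (by fun_prop) (by fun_prop) (by fun_prop))
  obtain ⟨K, hK⟩ := (isCompact_Icc.prod isCompact_Icc).exists_bound_of_continuousOn
    (s := Set.Icc lo hi ×ˢ Set.Icc (-1 : ℝ) 1) hcont.continuousOn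
  have hne : ∀ᵐ t : ℝ ∂volume, t ≠ 1 := compl_mem_ae_iff.2 (measure_singleton 1)
  have hmem : ∀ t : ℝ, t ≠ 1 → t ∈ Set.uIoc (-1 : ℝ) 1 → t ∈ Set.Ioo (-1 : ℝ) 1 := by
    intro t h ht
    rw [Set.uIoc_of_le (by norm_num)] at ht
    exact ⟨ht.1, lt_of_le_of_ne ht.2 h⟩
  refine intervalIntegral.continuousWithinAt_of_dominated_interval
    (bound := fun x => (1 - x ^ 2) ^ (-hi) * K) ?_ ?_ ?_ ?_
  · filter_upwards [self_mem_nhdsWithin] with μ hμ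
    exact (intervalIntegrable_iff.1 (jacobiIntegrand_intervalIntegrable (h0.trans_le hμ.1)
      (hμ.2.trans_lt h1) r n)).aestronglyMeasurable
  · filter_upwards [self_mem_nhdsWithin] with μ hμ
    filter_upwards [hne] with t ht ht'
    have hI := hmem t ht ht'
    rw [norm_mul, Real.norm_of_nonneg (weight_pos (-μ) hI).le]
    refine mul_le_mul ?_ (hK (μ, t) ⟨hμ, Set.Ioo_subset_Icc_self hI⟩) (norm_nonneg _)
      (weight_pos (-hi) hI).le
    exact Real.rpow_le_rpow_of_exponent_ge (by nlinarith [hI.1, hI.2])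
      (by nlinarith [sq_nonneg t]) (by linarith [hμ.2])
  · exact (weight_intervalIntegrable (by linarith) (by linarith)).mul_const K
  · filter_upwards [hne] with t ht ht'
    have hI := hmem t ht ht'
    have hw : Continuous fun μ : ℝ => (1 - t ^ 2) ^ (-μ) :=
      Continuous.rpow continuous_const continuous_neg fun μ => Or.inl
        (by nlinarith [hI.1, hI.2])
    exact (hw.mul (hcont.comp (by fun_prop : Continuous fun μ : ℝ => (μ, t)))).continuousWithinAt

theorem continuousOn_orderKernel {a b lo hi : ℝ} (hab : a < b) (h0 : 0 < lo) (h1 : hi < 1)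
    (r n : ℕ) : ContinuousOn (orderKernel a b r n) (Set.Icc lo hi) := by
  have hg : ∀ m : ℕ, ContinuousOn (fun μ => Real.Gamma (m + 1) / Real.Gamma (m - μ + 1))
      (Set.Icc lo hi) := by
    intro m μ hμ
    have hm : (0 : ℝ) ≤ m := Nat.cast_nonneg m
    have hpos : (0 : ℝ) < m - μ + 1 := by linarith [hμ.2]
    have hG : ContinuousAt Real.Gamma (m - μ + 1) :=
      (Real.differentiableAt_Gamma fun k => by
        have : (0 : ℝ) ≤ k := Nat.cast_nonneg k
        linarith).continuousAt
    exact (continuousAt_const.div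
      (ContinuousAt.comp (f := fun μ : ℝ => (m : ℝ) - μ + 1) hG (by fun_prop))
      (Real.Gamma_pos_of_pos hpos).ne').continuousWithinAt
  have hp : Continuous fun μ : ℝ => (2 / (b - a)) ^ (2 * μ - 1) :=
    Continuous.rpow continuous_const (by fun_prop) fun _ =>
      Or.inl (div_pos two_pos (sub_pos.2 hab)).ne'
  exact hp.continuousOn.mul (((hg r).mul (hg n)).mul (continuousOn_jacobiIntegral h0 h1 r n))

/-! ### Integration over the order -/

namespace OrderDistribution

variable (w : OrderDistribution)

theorem theta_mem {s : ℝ} (hs : s ∈ Set.Icc (-1 : ℝ) 1) : w.theta s ∈ Set.Icc w.lo w.hi := by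
  have := w.lo_lt_hi
  unfold theta
  constructor <;> nlinarith [hs.1, hs.2]

theorem theta_toStd (μ : ℝ) : w.theta (toStd w.lo w.hi μ) = μ := by
  have : w.hi - w.lo ≠ 0 := by linarith [w.lo_lt_hi]
  unfold theta toStd
  field_simp
  ring

/-- The weight times the modal pairing, as a function of the order. -/
noncomputable def modalDensity (a b : ℝ) (r n : ℕ) (μ : ℝ) : ℝ :=
  w.weight μ * orderKernel a b r n μ

theorem weight_intervalIntegrable : IntervalIntegrable w.weight volume w.lo w.hi :=
  (intervalIntegrable_iff_integrableOn_Ioo_of_le w.lo_lt_hi.le).2 w.integrable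

theorem modalDensity_intervalIntegrable {a b : ℝ} (hab : a < b) (r n : ℕ) :
    IntervalIntegrable (w.modalDensity a b r n) volume w.lo w.hi := by
  refine w.weight_intervalIntegrable.mul_continuousOn ?_
  rw [Set.uIcc_of_le w.lo_lt_hi.le]
  exact continuousOn_orderKernel hab w.lo_pos w.hi_lt_one r n

theorem orderIntegrand_eq (a b : ℝ) (r n : ℕ) (s : ℝ) :
    w.orderIntegrand a b r n s = w.modalDensity a b r n (w.theta s) := by
  rw [orderIntegrand, modalDensity, orderKernel, legendrePairing]
  ring

theorem orderIntegrand_intervalIntegrable {a b : ℝ} (hab : a < b) (r n : ℕ) :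
    IntervalIntegrable (w.orderIntegrand a b r n) volume (-1) 1 := by
  have h := w.lo_lt_hi
  have e : w.orderIntegrand a b r n = fun s =>
      w.modalDensity a b r n ((w.hi - w.lo) / 2 * s + (w.hi + w.lo) / 2) := by
    funext s
    rw [orderIntegrand_eq]
    congr 1
    unfold theta
    ring
  rw [e]
  refine intervalIntegrable_comp_affine (by linarith) ?_
  convert w.modalDensity_intervalIntegrable hab r n using 1 <;> ring

theorem modal_eq_integral (a b : ℝ) (r n : ℕ) :
    w.modal a b r n = ∫ s in (-1 : ℝ)..1, w.orderIntegrand a b r n s := by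
  refine intervalIntegral.integral_congr fun s hs => ?_
  rw [Set.uIcc_of_le (by norm_num)] at hs
  have hθ := w.theta_mem hs
  rw [fracPairing_legendre (hθ.2.trans_lt w.hi_lt_one), orderIntegrand_eq, modalDensity,
    orderKernel]
  ring

theorem integral_modalDensity (a b : ℝ) (r n : ℕ) :
    ∫ μ in w.lo..w.hi, w.modalDensity a b r n μ = (w.hi - w.lo) / 2 * w.modal a b r n := by
  have h := integral_comp_toStd w.lo_lt_hi
    (fun s => w.modalDensity a b r n (w.theta s)) w.lo w.hi
  simp only [theta_toStd, toStd_left, toStd_right w.lo_lt_hi] at h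
  rw [h, modal_eq_integral]
  simp only [orderIntegrand_eq]

theorem modal_symm (a b : ℝ) (r n : ℕ) :
    w.modal a b r n = (-1) ^ (r + n) * w.modal a b n r := by
  rw [modal_eq_integral, modal_eq_integral, ← intervalIntegral.integral_const_mul]
  refine intervalIntegral.integral_congr fun s _ => ?_
  simp only [orderIntegrand_eq, modalDensity]
  rw [orderKernel_symm]
  ring

theorem continuousOn_orderIntegrand {a b : ℝ} (hab : a < b) (r n : ℕ)
    (hw : ContinuousOn w.weight (Set.Icc w.lo w.hi)) :
    ContinuousOn (w.orderIntegrand a b r n) (Set.Icc (-1) 1) := by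
  have e : w.orderIntegrand a b r n = w.modalDensity a b r n ∘ w.theta :=
    funext (w.orderIntegrand_eq a b r n)
  rw [e]
  refine (hw.mul (continuousOn_orderKernel hab w.lo_pos w.hi_lt_one r n)).comp ?_
    fun s hs => w.theta_mem hs
  unfold theta
  fun_prop

theorem weight_mul_fracPairing_eq {a b : ℝ} (hab : a < b) (c d : ℝ) (r n : ℕ) {μ : ℝ}
    (hμ : μ ∈ Set.Icc w.lo w.hi) :
    w.weight μ * fracPairing a b μ (differenceFn a b c n) (differenceFn a b d r) =
      c * d * (w.modalDensity a b (r + 2) (n + 2) μ - w.modalDensity a b (r + 2) n μ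
        - w.modalDensity a b r (n + 2) μ + w.modalDensity a b r n μ) := by
  rw [fracPairing_difference hab (w.lo_pos.trans_le hμ.1) (hμ.2.trans_lt w.hi_lt_one)]
  simp only [modalDensity]
  ring

theorem weight_mul_fracPairing_intervalIntegrable {a b : ℝ} (hab : a < b) (c d : ℝ) (r n : ℕ) :
    IntervalIntegrable (fun μ => w.weight μ *
      fracPairing a b μ (differenceFn a b c n) (differenceFn a b d r)) volume w.lo w.hi := by
  have hi := w.modalDensity_intervalIntegrable hab
  refine ((((hi (r + 2) (n + 2)).sub (hi (r + 2) n)).sub (hi r (n + 2))).add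
    (hi r n)).const_mul (c * d) |>.congr fun μ hμ => ?_
  rw [Set.uIoc_of_le w.lo_lt_hi.le] at hμ
  exact (w.weight_mul_fracPairing_eq hab c d r n (Set.Ioc_subset_Icc_self hμ)).symm

theorem integral_weight_mul_fracPairing {a b : ℝ} (hab : a < b) (c d : ℝ) (r n : ℕ) :
    ∫ μ in w.lo..w.hi, w.weight μ *
      fracPairing a b μ (differenceFn a b c n) (differenceFn a b d r) =
      c * d * ((w.hi - w.lo) / 2) * (w.modal a b (r + 2) (n + 2) - w.modal a b (r + 2) n
        - w.modal a b r (n + 2) + w.modal a b r n) := by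
  have hi := w.modalDensity_intervalIntegrable hab
  have hcongr := intervalIntegral.integral_congr (μ := volume) (a := w.lo) (b := w.hi)
    fun μ hμ => w.weight_mul_fracPairing_eq hab c d r n
      (by rwa [Set.uIcc_of_le w.lo_lt_hi.le] at hμ)
  rw [hcongr, intervalIntegral.integral_const_mul, intervalIntegral.integral_add
    (((hi _ _).sub (hi _ _)).sub (hi _ _)) (hi _ _), intervalIntegral.integral_sub
    ((hi _ _).sub (hi _ _)) (hi _ _), intervalIntegral.integral_sub (hi _ _) (hi _ _)]
  simp only [integral_modalDensity]
  ring

end OrderDistribution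

/-! ### Entries and symmetry of the stiffness matrices -/

theorem leftStiffness_apply {a b : ℝ} (hab : a < b) (w : OrderDistribution) {M : ℕ}
    (r n : Fin M) :
    leftStiffness a b w M r n =
      testCoeff (r + 1) * trialCoeff (n + 1) * ((w.hi - w.lo) / 2) *
        (w.modal a b (r + 2) (n + 2) - w.modal a b (r + 2) n
          - w.modal a b r (n + 2) + w.modal a b r n) := by
  have h := w.integral_weight_mul_fracPairing hab (trialCoeff (n + 1)) (testCoeff (r + 1)) r n
  rw [leftStiffness, Matrix.of_apply]
  simp only [trialFn_succ, testFn_succ]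
  rw [h]
  ring

theorem rightStiffness_apply {a b : ℝ} (hab : a < b) (w : OrderDistribution) {M : ℕ}
    (r n : Fin M) :
    rightStiffness a b w M r n =
      testCoeff (r + 1) * trialCoeff (n + 1) * ((w.hi - w.lo) / 2) *
        (w.modal a b (n + 2) (r + 2) - w.modal a b n (r + 2)
          - w.modal a b (n + 2) r + w.modal a b n r) := by
  have h := w.integral_weight_mul_fracPairing hab (testCoeff (r + 1)) (trialCoeff (n + 1)) n r
  rw [rightStiffness, Matrix.of_apply]
  simp only [trialFn_succ, testFn_succ]
  rw [h]
  ring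

/-- Because σ̃_m = (-1)^m σ_m, exchanging the two modes changes the product by the sign (-1)^(n+r);
the shifts to n + 1 and r + 1 do not alter that parity. -/
theorem testCoeff_mul_trialCoeff (r n : ℕ) :
    testCoeff (n + 1) * trialCoeff (r + 1) * (-1) ^ (n + r) =
      testCoeff (r + 1) * trialCoeff (n + 1) := by
  have hr : ((-1 : ℝ) ^ r) * (-1) ^ r = 1 := by rw [← mul_pow]; norm_num
  have hn : ((-1 : ℝ) ^ n) * (-1) ^ n = 1 := by rw [← mul_pow]; norm_num
  rw [testCoeff, testCoeff, trialCoeff, trialCoeff, pow_succ, pow_succ, pow_add]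
  generalize (-1 : ℝ) ^ r = e at *
  generalize (-1 : ℝ) ^ n = f at *
  linear_combination (-f + 2 * f * f) * hr + (2 - 4 * e) * hn

/-- All four index pairs have the parity of r + n, so transposition multiplies the whole bracket by
one sign, which the coefficients cancel. -/
theorem leftStiffness_isSymm {a b : ℝ} (hab : a < b) (w : OrderDistribution) (M : ℕ) :
    (leftStiffness a b w M).IsSymm := by
  refine Matrix.IsSymm.ext fun n r => ?_
  rw [leftStiffness_apply hab, leftStiffness_apply hab, w.modal_symm a b (r + 2) (n + 2),
    w.modal_symm a b (r + 2) n, w.modal_symm a b r (n + 2), w.modal_symm a b r n,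
    ← testCoeff_mul_trialCoeff n r]
  ring

theorem rightStiffness_isSymm {a b : ℝ} (hab : a < b) (w : OrderDistribution) (M : ℕ) :
    (rightStiffness a b w M).IsSymm := by
  refine Matrix.IsSymm.ext fun n r => ?_
  rw [rightStiffness_apply hab, rightStiffness_apply hab, w.modal_symm a b (n + 2) (r + 2),
    w.modal_symm a b n (r + 2), w.modal_symm a b (n + 2) r, w.modal_symm a b n r,
    ← testCoeff_mul_trialCoeff n r]
  ring

theorem totalStiffness_eq {a b : ℝ} (hab : a < b) (ϱ ρ : OrderDistribution)
    (cl cr κl κr : ℝ) (M : ℕ) :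
    totalStiffness a b ϱ ρ cl cr κl κr M =
      cl • leftStiffness a b ϱ M + cr • rightStiffness a b ϱ M
        - κl • leftStiffness a b ρ M - κr • rightStiffness a b ρ M := by
  have key : ∀ (w : OrderDistribution) (c d : ℝ) (r n : Fin M),
      ∫ μ in w.lo..w.hi, w.weight μ *
        (c * fracPairing a b μ (trialFn a b (n + 1)) (testFn a b (r + 1)) +
          d * fracPairing a b μ (testFn a b (r + 1)) (trialFn a b (n + 1))) =
      c * leftStiffness a b w M r n + d * rightStiffness a b w M r n := by
    intro w c d r n
    simp only [leftStiffness, rightStiffness, Matrix.of_apply, trialFn_succ, testFn_succ]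
    rw [← intervalIntegral.integral_const_mul, ← intervalIntegral.integral_const_mul,
      ← intervalIntegral.integral_add
        ((w.weight_mul_fracPairing_intervalIntegrable hab _ _ _ _).const_mul c)
        ((w.weight_mul_fracPairing_intervalIntegrable hab _ _ _ _).const_mul d)]
    refine intervalIntegral.integral_congr fun μ _ => ?_
    ring
  ext r n
  rw [totalStiffness, Matrix.of_apply, spatialForm, key, key]
  simp only [Matrix.sub_apply, Matrix.add_apply, Matrix.smul_apply, smul_eq_mul]
  ring

theorem totalStiffness_isSymm {a b : ℝ} (hab : a < b) (ϱ ρ : OrderDistribution)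
    (cl cr κl κr : ℝ) (M : ℕ) : (totalStiffness a b ϱ ρ cl cr κl κr M).IsSymm := by
  rw [totalStiffness_eq hab]
  exact ((((leftStiffness_isSymm hab ϱ M).smul cl).add
    ((rightStiffness_isSymm hab ϱ M).smul cr)).sub
    ((leftStiffness_isSymm hab ρ M).smul κl)).sub ((rightStiffness_isSymm hab ρ M).smul κr)

/-- A Gauss rule with enough points evaluates the Jacobi integral exactly. -/
theorem jacobiIntegral_eq_gaussSum {μ : ℝ} (h0 : 0 < μ) (h1 : μ < 1) {r n Q : ℕ}
    (hQ : r + n < 2 * Q) :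
    jacobiIntegral μ r n = gaussSum (-μ) Q
      (fun ξ => (jacobi (-μ) μ r).eval ξ * (jacobi μ (-μ) n).eval ξ) := by
  have hd : (jacobi (-μ) μ r * jacobi μ (-μ) n).degree < (2 * Q : ℕ) := by
    refine lt_of_le_of_lt degree_le_natDegree ?_
    have := natDegree_mul_le (p := jacobi (-μ) μ r) (q := jacobi μ (-μ) n)
    have := natDegree_jacobi_le (-μ) μ r
    have := natDegree_jacobi_le μ (-μ) n
    exact_mod_cast (by omega)
  have h := gaussSum_exact (by linarith : -1 < -μ) (by linarith) hd
  simp only [weightIntegral, eval_mul] at h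
  exact h.symm

end StiffnessMatrix

open StiffnessMatrix in
theorem lemmaA1 (a b : ℝ) (hab : a < b) (ϱ ρ : OrderDistribution) (cl cr κl κr : ℝ) (M : ℕ) :
    -- the total matrix is symmetric and is the stated combination of the one-sided matrices
    (totalStiffness a b ϱ ρ cl cr κl κr M).IsSymm ∧
    totalStiffness a b ϱ ρ cl cr κl κr M =
      cl • leftStiffness a b ϱ M + cr • rightStiffness a b ϱ M
        - κl • leftStiffness a b ρ M - κr • rightStiffness a b ρ M ∧
    -- closed form of the fractional derivatives of the Legendre polynomials
    (∀ μ : ℝ, 0 < μ → μ < 1 → ∀ (n : ℕ) (ξ : ℝ), -1 < ξ → ξ < 1 →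
      leftRL (-1) μ (fun x => (legendre n).eval x) ξ =
        Real.Gamma (n + 1) / Real.Gamma (n - μ + 1) *
          (jacobi μ (-μ) n).eval ξ * (1 + ξ) ^ (-μ) ∧
      rightRL 1 μ (fun x => (legendre n).eval x) ξ =
        Real.Gamma (n + 1) / Real.Gamma (n - μ + 1) *
          (jacobi (-μ) μ n).eval ξ * (1 - ξ) ^ (-μ)) ∧
    -- for each order distribution: the entries of the one-sided matrices
    ∀ w : OrderDistribution, w = ϱ ∨ w = ρ →
      (leftStiffness a b w M).IsSymm ∧ (rightStiffness a b w M).IsSymm ∧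
      -- the integrals that define the entries converge
      (∀ r n : Fin M,
        (∀ μ ∈ Set.Icc w.lo w.hi,
          IntervalIntegrable (fun x => leftRL a μ (trialFn a b (n + 1)) x *
            rightRL b μ (testFn a b (r + 1)) x) MeasureTheory.volume a b ∧
          IntervalIntegrable (fun x => leftRL a μ (testFn a b (r + 1)) x *
            rightRL b μ (trialFn a b (n + 1)) x) MeasureTheory.volume a b) ∧
        IntervalIntegrable (fun μ => w.weight μ *
          fracPairing a b μ (trialFn a b (n + 1)) (testFn a b (r + 1)))
          MeasureTheory.volume w.lo w.hi ∧
        IntervalIntegrable (fun μ => w.weight μ *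
          fracPairing a b μ (testFn a b (r + 1)) (trialFn a b (n + 1)))
          MeasureTheory.volume w.lo w.hi) ∧
      -- reduction of the entries to the modal integrals; here the mode numbers are `r + 1`, `n + 1`
      (∀ r n : Fin M,
        leftStiffness a b w M r n =
          testCoeff (r + 1) * trialCoeff (n + 1) * ((w.hi - w.lo) / 2) *
            (w.modal a b (r + 2) (n + 2) - w.modal a b (r + 2) n
              - w.modal a b r (n + 2) + w.modal a b r n) ∧
        rightStiffness a b w M r n =
          testCoeff (r + 1) * trialCoeff (n + 1) * ((w.hi - w.lo) / 2) *
            (w.modal a b (n + 2) (r + 2) - w.modal a b n (r + 2)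
              - w.modal a b (n + 2) r + w.modal a b n r)) ∧
      -- exact evaluation of the modal integrals
      ∀ r n : ℕ, r ≤ M + 1 → n ≤ M + 1 →
        (∀ μ ∈ Set.Icc w.lo w.hi,
          IntervalIntegrable (fun ξ => (1 - ξ ^ 2) ^ (-μ) *
            ((jacobi (-μ) μ r).eval ξ * (jacobi μ (-μ) n).eval ξ))
            MeasureTheory.volume (-1) 1) ∧
        IntervalIntegrable (w.orderIntegrand a b r n) MeasureTheory.volume (-1) 1 ∧
        w.modal a b r n = ∫ s in (-1 : ℝ)..1, w.orderIntegrand a b r n s ∧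
        w.modal a b r n = (-1) ^ (r + n) * w.modal a b n r ∧
        -- the space integral is computed exactly by a Gauss rule with `Q ≥ M + 2` points
        (∀ μ ∈ Set.Icc w.lo w.hi, ∀ Q : ℕ, M + 2 ≤ Q →
          jacobiIntegral μ r n = gaussSum (-μ) Q
            (fun ξ => (jacobi (-μ) μ r).eval ξ * (jacobi μ (-μ) n).eval ξ)) ∧
        -- the `Q`-point Gauss–Legendre rule in the order: exact for polynomial integrands of degree
        -- below `2 Q` (`ε = 0`), with the corresponding error bound in general
        (∀ (Q : ℕ) (p : Polynomial ℝ) (ε : ℝ), p.degree < (2 * Q : ℕ) →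
          (∀ s ∈ Set.Icc (-1 : ℝ) 1, |w.orderIntegrand a b r n s - p.eval s| ≤ ε) →
          |w.modal a b r n - gaussSum 0 Q (w.orderIntegrand a b r n)| ≤ 4 * ε) ∧
        -- and convergent for every continuous weight
        (ContinuousOn w.weight (Set.Icc w.lo w.hi) →
          Filter.Tendsto (fun Q : ℕ => gaussSum 0 Q (w.orderIntegrand a b r n))
            Filter.atTop (nhds (w.modal a b r n))) := by
  refine ⟨totalStiffness_isSymm hab ϱ ρ cl cr κl κr M, totalStiffness_eq hab ϱ ρ cl cr κl κr M,
    fun μ _ h1 n ξ hξ hξ' => ⟨leftRL_legendre h1 hξ n, rightRL_legendre h1 hξ' n⟩,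
    fun w _ => ⟨leftStiffness_isSymm hab w M, rightStiffness_isSymm hab w M, fun r n =>
      ⟨fun μ hμ => ?_, w.weight_mul_fracPairing_intervalIntegrable hab _ _ _ _,
        w.weight_mul_fracPairing_intervalIntegrable hab _ _ _ _⟩, fun r n =>
      ⟨leftStiffness_apply hab w r n, rightStiffness_apply hab w r n⟩, fun r n hr hn =>
      ⟨fun μ hμ => ?_, w.orderIntegrand_intervalIntegrable hab r n, w.modal_eq_integral a b r n,
        w.modal_symm a b r n, fun μ hμ Q hQ => ?_, fun Q p ε hp h => ?_, fun hw => ?_⟩⟩⟩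
  · have h0 := w.lo_pos.trans_le hμ.1
    have h1 := hμ.2.trans_lt w.hi_lt_one
    exact ⟨difference_intervalIntegrable hab h0 h1 _ _ _ _,
      difference_intervalIntegrable hab h0 h1 _ _ _ _⟩
  · exact jacobiIntegrand_intervalIntegrable (w.lo_pos.trans_le hμ.1)
      (hμ.2.trans_lt w.hi_lt_one) r n
  -- Here r + n ≤ 2M + 2 < 2(M + 2) ≤ 2Q.
  · exact jacobiIntegral_eq_gaussSum (w.lo_pos.trans_le hμ.1) (hμ.2.trans_lt w.hi_lt_one)
      (by omega)
  · rw [w.modal_eq_integral]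
    exact abs_integral_sub_gaussSum_le (w.orderIntegrand_intervalIntegrable hab r n) hp h
  · rw [w.modal_eq_integral]
    exact tendsto_gaussSum (w.continuousOn_orderIntegrand hab r n hw)
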